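/- Let $\mathcal S=\{(1,0),(1,-1),(-2,1),(-2,0)\}$, let $S(x,y)=x+x\bar y+\bar x^2y+\bar x^2$ with $\bar x=1/x$, $\bar y=1/y$, and let $q(i,j;n)$ be the number of $n$-step walks with steps in $\mathcal S$ that go from $(0,0)$ to $(i,j)$ and stay in $\mathbb N^2$ (where $\mathbb N=\{0,1,2,\dots\}$). Put $Q(x,y)=\sum_{i,j,n\ge 0}q(i,j;n)x^iy^jt^n$. 1. Let $\overline{\mathbb K}$ be an algebraic closure of $\mathbb C(x,y)$. Call two distinct pairs $u,v\in(\overline{\mathbb K}\setminus\{0\})^2$ adjacent if $S(u)=S(v)$ and $u,v$ differ in one coordinate only, and let the orbit be the equivalence class of $(x,y)$ under the reflexive and transitive closure of adjacency. The orbit has exactly $18$ elements. 2. One has $$Q(x,y)=[x^{\ge}y^{\ge}]\,\frac{(2-y)(x^3-y^2)(x^6y-3x^3y-x^3-y^2)(x^3-2y)}{x^9y^4\bigl(1-t(\bar x^2+\bar x^2y+x\bar y+x)\bigr)},$$ where the fraction is seen as a power series in $t$ with coefficients in $\mathbb Q[x,\bar x,y,\bar y]$, and $[x^{\ge}y^{\ge}]$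 retains the monomials $x^ay^bt^n$ with $a,b\ge 0$. 3. For $i,j,n\ge 0$, $q(i,j;n)$ is zero unless $n$ is of the form $n=i+3j+3m$ with $m\ge 0$ an integer, in which case $$q(i,j;n)=\frac{(i+1)(j+1)(i+3j+4)\bigl((i+2j+2)(i+2j+3)+m(2i+3j+4)\bigr)\,n!\,(n+3)!}{m!\,(m+j+1)!\,(2m+i+2j+3)!\,(2m+i+3j+4)!}.$$ 4. The excursion exponent and the walk exponent are both $-5$. Precisely, let $\mu=9\cdot 4^{-2/3}$. For all $i,j\ge 0$ there is $\kappa_{i,j}>0$ such that $q(i,j;n)\sim\kappa_{i,j}\,\mu^n n^{-5}$ as $n\to\infty$ with $n\equiv i \pmod 3$. For each residue $r$ modulo $3$ there is $\kappa_r>0$ such that the total number $q_n=\sum_{i,j}q(i,j;n)$ of $n$-step quadrant walks satisfies $q_n\sim\kappa_r\,\mu^n n^{-5}$ as $n\to\infty$ with $n\equiv r\pmod 3$. -/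

import Mathlib

open Filter Asymptotics
open scoped PowerSeries Nat

noncomputable section

namespace QuadrantWalk

/-! ### Walks in the quadrant -/

/-- The endpoint of the first `m` steps of a walk that starts at the origin. -/
def position {n : ℕ} (w : Fin n → ℤ × ℤ) (m : ℕ) : ℤ × ℤ :=
  ∑ k ∈ (Finset.univ : Finset (Fin n)).filter (fun k => k.val < m), w k

/-- The quadrant walks with `n` steps in `S` starting at the origin: sequences of `n` steps of `S`
such that all visited points lie in `ℕ²`. -/
def walks (S : Finset (ℤ × ℤ)) (n : ℕ) : Finset (Fin n → ℤ × ℤ) :=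
  (Fintype.piFinset fun _ : Fin n => S).filter
    fun w : Fin n → ℤ × ℤ => ∀ m : Fin (n + 1), 0 ≤ (position w m).1 ∧ 0 ≤ (position w m).2

/-- The endpoint of a walk that starts at the origin. -/
def endpoint {n : ℕ} (w : Fin n → ℤ × ℤ) : ℤ × ℤ := ∑ k, w k

/-- `q(i,j;n)`: the number of `n`-step quadrant walks from `(0,0)` to `(i,j)`. -/
def q (S : Finset (ℤ × ℤ)) (i j n : ℕ) : ℕ :=
  ((walks S n).filter fun w => endpoint w = ((i : ℤ), (j : ℤ))).card

/-- The number of all `n`-step quadrant walks from `(0,0)`: the coefficient of `t^n` in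
`Q(1,1;t)`. -/
def qTotal (S : Finset (ℤ × ℤ)) (n : ℕ) : ℕ := (walks S n).card

/-! ### Generating functions in `ℚ[x, x⁻¹, y, y⁻¹][[t]]` -/

/-- Laurent polynomials in `x` and `y`; the coefficient of `x^a y^b` is that of `(a, b)`. -/
abbrev Laurent : Type := AddMonoidAlgebra ℚ (ℤ × ℤ)

/-- The monomial `x^a y^b`. -/
def mono (s : ℤ × ℤ) : Laurent := AddMonoidAlgebra.single s 1

/-- The variable `x`. -/
def x : Laurent := mono (1, 0)

/-- The variable `y`. -/
def y : Laurent := mono (0, 1)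

/-- The step polynomial `S(x,y)`. -/
def stepPoly (S : Finset (ℤ × ℤ)) : Laurent := ∑ s ∈ S, mono s

/-- The generating function `Q(x,y;t)`: each quadrant walk contributes
`x^i y^j t^n`, where `(i,j)` is its endpoint and `n` its length. -/
def Q (S : Finset (ℤ × ℤ)) : PowerSeries Laurent :=
  PowerSeries.mk fun n => ∑ w ∈ walks S n, mono (endpoint w)

/-- The coefficient of `x^i y^j t^n` in `Q(x,y;t)` is `q(i,j;n)`. -/
theorem coeff_Q (S : Finset (ℤ × ℤ)) (i j n : ℕ) :
    (PowerSeries.coeff n (Q S)).coeff ((i : ℤ), (j : ℤ)) = q S i j n := by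
  classical
  simp [Q, q, mono, Finsupp.single_apply]

/-- The part of a Laurent polynomial that is non-negative in `x` and in `y`. -/
def Laurent.nonneg (p : Laurent) : Laurent :=
  .ofCoeff (p.coeff.filter fun s => 0 ≤ s.1 ∧ 0 ≤ s.2)

/-- The non-negative part `[x^≥ y^≥] F` of a power series in `t` with coefficients in
`ℚ[x, x⁻¹, y, y⁻¹]`. -/
def nonnegPart (F : PowerSeries Laurent) : PowerSeries Laurent :=
  PowerSeries.mk fun n => (PowerSeries.coeff n F).nonneg

/-! ### The orbit -/

/-- The field `ℂ(x,y)`. -/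
abbrev RatField : Type := FractionRing (MvPolynomial (Fin 2) ℂ)

/-- An algebraic closure of `ℂ(x,y)`. -/
abbrev RatClosure : Type := AlgebraicClosure RatField

/-- The pair `(x,y)`, where `x` and `y` are the two indeterminates. -/
def genericPair : RatClosure × RatClosure :=
  (algebraMap RatField RatClosure (algebraMap (MvPolynomial (Fin 2) ℂ) RatField (MvPolynomial.X 0)),
   algebraMap RatField RatClosure (algebraMap (MvPolynomial (Fin 2) ℂ) RatField (MvPolynomial.X 1)))

/-- The value `S(u,v)` of the step polynomial in a field (at non-zero `u`, `v`). -/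
def stepEval {K : Type*} [Field K] (S : Finset (ℤ × ℤ)) (u : K × K) : K :=
  ∑ s ∈ S, u.1 ^ s.1 * u.2 ^ s.2

/-- Adjacency: two distinct pairs of non-zero elements with the same value of `S` that differ by
one coordinate only. -/
def Adjacent {K : Type*} [Field K] (S : Finset (ℤ × ℤ)) (u v : K × K) : Prop :=
  (u.1 ≠ 0 ∧ u.2 ≠ 0) ∧ (v.1 ≠ 0 ∧ v.2 ≠ 0) ∧ u ≠ v ∧ stepEval S u = stepEval S v ∧
    (u.2 = v.2 ∨ u.1 = v.1)

/-- The orbit of the model: the class of `(x,y)` for the reflexive transitive closure of the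
(symmetric) adjacency relation. -/
def orbit (S : Finset (ℤ × ℤ)) : Set (RatClosure × RatClosure) :=
  {v | Relation.ReflTransGen (Adjacent S) genericPair v}

/-! ### Asymptotic exponents -/

/-- `a n ∼ κ μ^n n^α` for some `κ > 0`, as `n → ∞` in the residue class of `r` modulo `p`. -/
def HasExponent (a : ℕ → ℕ) (p r : ℕ) (μ α : ℝ) : Prop :=
  ∃ κ : ℝ, 0 < κ ∧
    (fun n => (a n : ℝ)) ~[atTop ⊓ 𝓟 {n | n ≡ r [MOD p]}]
      fun n => κ * μ ^ n * (n : ℝ) ^ α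

/-- The step set `{(1,0), (1,-1), (-2,1), (-2,0)}`. -/
def steps : Finset (ℤ × ℤ) := {(1, 0), (1, -1), (-2, 1), (-2, 0)}

end QuadrantWalk

end

/-! The orbit. The step polynomial factors as `S(a, b) = (1 + b)(1 + a³/b)/a²`. With `u = b` and `v
= a³/b` this reads `a³ = uv` and `s a² = (1 + u)(1 + v)`, so `f(u) f(v) = s³` for `f(u) = (1 +
u)³/u²`. Changing the second coordinate exchanges `u` and `v`; changing the first keeps `u` and
moves `v` in its fibre of `f`. The orbit is thus described by a point of the fibre of `y`, a point
of the fibre of `z = x³/y`, and the choice of which one is the second coordinate. Both fibres have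
three elements, whence `2 · 3 · 3 = 18` (`setOf_reflTransGen_adjacent`, `ncard_levelSet`).

The coefficients. The closed form satisfies the recursion on the last step and vanishes on the lines
`i = -1` and `j = -1`, so it counts quadrant walks (`closedForm_succ`, `walkCount_steps`).

The non-negative part. Since `S = (1 + 1/y)(x + y/x²)`, the coefficients of `S ^ n` are products of
two binomial coefficients. The coefficients of the numerator times `S ^ n / (x⁹y⁴)` are then
explicit, and a polynomial identity shows that they equal the closed form
(`coeff_numerator_mul_eq_closedForm`). Orbit sums are not needed.

The asymptotics. Up to rational factors, `q(i,j;n)/μ ^ n` is a product of two binomial probabilities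
of parameters `n + 4` and `1/3`, both near the mode and of order `n^(-1/2)` (`q_steps_mul_eq`). The
rational factors contribute order `n^(-4)`, which gives the exponent `-5`. A bound summable over the
endpoints gives the total count by dominated convergence (`q_steps_mul_le`,
`hasExponent_qTotal_steps`). -/

noncomputable section

namespace QuadrantWalk

/-! ### The orbit -/

section Orbit

variable {K : Type*} [Field K]

/-- The non-zero `b` with `(1 + b) ^ 3 / b ^ 2 = (1 + y) ^ 3 / y ^ 2`. -/
def levelSet (y : K) : Set K := {b | b ≠ 0 ∧ (1 + b) ^ 3 * y ^ 2 = (1 + y) ^ 3 * b ^ 2}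

theorem self_mem_levelSet {y : K} (hy : y ≠ 0) : y ∈ levelSet y := ⟨hy, rfl⟩

theorem one_add_ne_zero_of_mem_levelSet {y b : K} (h1y : 1 + y ≠ 0) (h : b ∈ levelSet y) :
    1 + b ≠ 0 := by
  intro h0
  have := h.2
  rw [h0] at this
  have h2 : (1 + y) ^ 3 * b ^ 2 ≠ 0 := mul_ne_zero (pow_ne_zero _ h1y) (pow_ne_zero _ h.1)
  exact h2 (by rw [← this]; ring)

/-- Once `b = y` is divided out, the cubic leaves a quadratic whose roots are rational in `α = √(1 +
4y)`. The excluded values `-1`, `2` and `-1/4` are those where roots collide: `-1` is the triple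
zero of `(1 + b)³/b²`, `2` is its other critical point, and `-1/4` lies in the same fibre as `2`. -/
theorem ncard_levelSet [IsAlgClosed K] [CharZero K] {y : K} (hy : y ≠ 0) (h1 : 1 + y ≠ 0)
    (h4 : 1 + 4 * y ≠ 0) (h2 : y ≠ 2) : (levelSet y).ncard = 3 := by
  obtain ⟨α, hα⟩ := IsAlgClosed.exists_pow_nat_eq (1 + 4 * y) (n := 2) (by norm_num)
  have hyα : y = (α ^ 2 - 1) / 4 := by rw [hα]; ring
  have ha0 : α ≠ 0 := by rintro rfl; exact h4 (by rw [← hα]; ring)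
  have ha1 : α - 1 ≠ 0 := by
    intro h; apply hy; rw [hyα, show α ^ 2 - 1 = (α - 1) * (α + 1) by ring, h]; ring
  have ha2 : α + 1 ≠ 0 := by
    intro h; apply hy; rw [hyα, show α ^ 2 - 1 = (α - 1) * (α + 1) by ring, h]; ring
  have ha3 : α - 3 ≠ 0 := by
    intro h; apply h2; rw [hyα, show α ^ 2 - 1 = (α - 3) * (α + 3) + 8 by ring, h]; norm_num
  have ha4 : α + 3 ≠ 0 := by
    intro h; apply h2; rw [hyα, show α ^ 2 - 1 = (α - 3) * (α + 3) + 8 by ring, h]; norm_num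
  have ha5 : α ^ 2 + 3 ≠ 0 := by
    intro h; apply h1; rw [hyα, show 1 + (α ^ 2 - 1) / 4 = (α ^ 2 + 3) / 4 by ring, h]; ring
  have key : levelSet y = {y, 2 * (α + 1) / (α - 1) ^ 2, 2 * (1 - α) / (α + 1) ^ 2} := by
    ext b
    have hfac : (1 + b) ^ 3 * y ^ 2 - (1 + y) ^ 3 * b ^ 2 =
        (b - y) * (b - 2 * (α + 1) / (α - 1) ^ 2) * (b - 2 * (1 - α) / (α + 1) ^ 2) * y ^ 2 := by
      rw [hyα]; field_simp; ring
    have hy1 : 2 * (α + 1) / (α - 1) ^ 2 ≠ 0 :=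
      div_ne_zero (mul_ne_zero two_ne_zero ha2) (pow_ne_zero _ ha1)
    have hy2 : 2 * (1 - α) / (α + 1) ^ 2 ≠ 0 :=
      div_ne_zero (mul_ne_zero two_ne_zero (by rw [← neg_sub]; exact neg_ne_zero.2 ha1))
        (pow_ne_zero _ ha2)
    simp only [levelSet, Set.mem_ofPred_eq, Set.mem_insert_iff, Set.mem_singleton_iff]
    rw [← sub_eq_zero (a := (1 + b) ^ 3 * y ^ 2), hfac]
    simp only [mul_eq_zero, sub_eq_zero, pow_eq_zero_iff, hy, ne_eq, OfNat.ofNat_ne_zero,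
      not_false_eq_true, or_false]
    constructor
    · rintro ⟨-, (h | h) | h⟩ <;> simp [h]
    · rintro (h | h | h)
      · exact ⟨h ▸ hy, Or.inl (Or.inl h)⟩
      · exact ⟨h ▸ hy1, Or.inl (Or.inr h)⟩
      · exact ⟨h ▸ hy2, Or.inr h⟩
  rw [key, Set.ncard_eq_three]
  refine ⟨_, _, _, ?_, ?_, ?_, rfl⟩
  · rw [hyα, ne_eq, div_eq_div_iff (by norm_num) (pow_ne_zero _ ha1)]
    intro h
    have : (α + 1) * (α - 3) * (α ^ 2 + 3) = 0 := by linear_combination h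
    exact mul_ne_zero (mul_ne_zero ha2 ha3) ha5 this
  · rw [hyα, ne_eq, div_eq_div_iff (by norm_num) (pow_ne_zero _ ha2)]
    intro h
    have : (α - 1) * (α + 3) * (α ^ 2 + 3) = 0 := by linear_combination h
    exact mul_ne_zero (mul_ne_zero ha1 ha4) ha5 this
  · rw [ne_eq, div_eq_div_iff (pow_ne_zero _ ha1) (pow_ne_zero _ ha2)]
    intro h
    have : 4 * (α * (α ^ 2 + 3)) = 0 := by linear_combination h
    exact mul_ne_zero (by norm_num : (4 : K) ≠ 0) (mul_ne_zero ha0 ha5) this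

theorem stepEval_steps {a b : K} (ha : a ≠ 0) (hb : b ≠ 0) :
    stepEval steps (a, b) = (1 + b) * (1 + a ^ 3 / b) / a ^ 2 := by
  simp only [stepEval, steps]
  rw [Finset.sum_insert (by decide), Finset.sum_insert (by decide), Finset.sum_insert (by decide),
    Finset.sum_singleton]
  simp only [zpow_one, zpow_zero, zpow_neg, mul_one, show (-2 : ℤ) = -(2 : ℕ) from rfl,
    zpow_natCast]
  field_simp
  ring

/-- `u` and `v = a ^ 3 / u` are the second coordinates of the two pairs with first coordinate `a`
at which the step polynomial takes the value `s`; then `a ^ 3 = u v`, and eliminating `a` gives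
this relation. -/
def Linked (s u v : K) : Prop := (1 + u) ^ 3 * (1 + v) ^ 3 = s ^ 3 * u ^ 2 * v ^ 2

theorem Linked.symm {s u v : K} (h : Linked s u v) : Linked s v u := by
  unfold Linked at *; linear_combination h

theorem linked_of_stepEval {s a b : K} (ha : a ≠ 0) (hb : b ≠ 0)
    (h : stepEval steps (a, b) = s) : Linked s b (a ^ 3 / b) := by
  rw [← h, stepEval_steps ha hb, Linked]
  field_simp

/-- With `f(u) = (1 + u)³/u²`, one has `f(y) f(z) = s³ = f(u) f(v)` and `f(u) = f(y)`; the condition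
`1 + y ≠ 0` makes `f(y)` cancellable. -/
theorem Linked.mem_levelSet {s y z u v : K} (h1y : 1 + y ≠ 0)
    (hyz : Linked s y z) (huv : Linked s u v) (hv : v ≠ 0) (hu : u ∈ levelSet y) :
    v ∈ levelSet z := by
  refine ⟨hv, ?_⟩
  have h1u := one_add_ne_zero_of_mem_levelSet h1y hu
  have h := hu.2
  unfold Linked at *
  have hne : (1 + u) ^ 3 * (1 + y) ^ 3 ≠ 0 := mul_ne_zero (pow_ne_zero _ h1u) (pow_ne_zero _ h1y)
  apply mul_left_cancel₀ hne
  linear_combination z ^ 2 * (1 + y) ^ 3 * huv - v ^ 2 * (1 + u) ^ 3 * hyz -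
    s ^ 3 * v ^ 2 * z ^ 2 * h

theorem Linked.of_mem_levelSet {s y z u v : K} (hy : y ≠ 0) (hz : z ≠ 0)
    (hyz : Linked s y z) (hu : u ∈ levelSet y) (hv : v ∈ levelSet z) : Linked s u v := by
  have h := hu.2
  have h' := hv.2
  unfold Linked at *
  have hne : y ^ 2 * z ^ 2 ≠ 0 := mul_ne_zero (pow_ne_zero _ hy) (pow_ne_zero _ hz)
  apply mul_left_cancel₀ hne
  linear_combination (1 + v) ^ 3 * z ^ 2 * h + (1 + y) ^ 3 * u ^ 2 * h' + u ^ 2 * v ^ 2 * hyz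

/-- The first coordinate of the pairs with second coordinates `u` and `v`. -/
def linkCoord (s u v : K) : K := s * u * v / ((1 + u) * (1 + v))

theorem linkCoord_comm (s u v : K) : linkCoord s u v = linkCoord s v u := by
  unfold linkCoord; ring

theorem linkCoord_pow_three {s u v : K} (h : Linked s u v) (hu : 1 + u ≠ 0) (hv : 1 + v ≠ 0) :
    linkCoord s u v ^ 3 = u * v := by
  unfold linkCoord Linked at *
  field_simp
  linear_combination -u * v * h

theorem stepEval_linkCoord {s u v : K} (h : Linked s u v) (hs : s ≠ 0) (hu0 : u ≠ 0) (hv0 : v ≠ 0)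
    (hu : 1 + u ≠ 0) (hv : 1 + v ≠ 0) : stepEval steps (linkCoord s u v, u) = s := by
  have h0 : linkCoord s u v ≠ 0 := by unfold linkCoord; simp [hs, hu0, hv0, hu, hv]
  rw [stepEval_steps h0 hu0, linkCoord_pow_three h hu hv]
  unfold linkCoord Linked at *
  field_simp
  linear_combination h

/-- For `u = b` and `v = a³/b`, the quotient of `a³ = uv` by `a² = (1 + u)(1 + v)/s` recovers `a`
without a choice of cube root. -/
theorem linkCoord_eq {s a b : K} (ha : a ≠ 0) (hb : b ≠ 0) (hs : s ≠ 0)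
    (h : stepEval steps (a, b) = s) : linkCoord s b (a ^ 3 / b) = a := by
  rw [stepEval_steps ha hb] at h
  have h1 : 1 + b ≠ 0 := by rintro h1; apply hs; rw [← h, h1]; ring
  have h2 : 1 + a ^ 3 / b ≠ 0 := by rintro h1; apply hs; rw [← h, h1]; ring
  have h3 : b + a ^ 3 ≠ 0 := by
    intro h3; apply h2; field_simp; linear_combination h3
  rw [linkCoord, ← h]
  field_simp

theorem setOf_reflTransGen_adjacent {x y s : K} (hx : x ≠ 0) (hy : y ≠ 0) (h1y : 1 + y ≠ 0)
    (h1z : 1 + x ^ 3 / y ≠ 0) (hs : stepEval steps (x, y) = s) :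
    {v | Relation.ReflTransGen (Adjacent steps) (x, y) v} =
      {p | p.1 ≠ 0 ∧ p.2 ≠ 0 ∧ stepEval steps p = s ∧
        (p.2 ∈ levelSet y ∨ p.2 ∈ levelSet (x ^ 3 / y))} := by
  set z := x ^ 3 / y with hz
  have hz0 : z ≠ 0 := div_ne_zero (pow_ne_zero _ hx) hy
  have hs0 : s ≠ 0 := by
    rw [← hs, stepEval_steps hx hy]
    exact div_ne_zero (mul_ne_zero h1y h1z) (pow_ne_zero _ hx)
  have hyz : Linked s y z := linked_of_stepEval hx hy hs
  have hconj : ∀ {a b : K}, a ≠ 0 → b ≠ 0 → stepEval steps (a, b) = s →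
      stepEval steps (a, a ^ 3 / b) = s := by
    intro a b ha hb h
    rw [← h, stepEval_steps ha hb, stepEval_steps ha (div_ne_zero (pow_ne_zero _ ha) hb)]
    field_simp
  ext ⟨a, b⟩
  simp only [Set.mem_ofPred_eq]
  constructor
  · intro h
    have hinv : ∀ p : K × K, Relation.ReflTransGen (Adjacent steps) (x, y) p →
        p.1 ≠ 0 ∧ p.2 ≠ 0 ∧ stepEval steps p = s ∧ (p.2 ∈ levelSet y ∨ p.2 ∈ levelSet z) := by
      intro p hp
      induction hp with
      | refl => exact ⟨hx, hy, hs, Or.inl (self_mem_levelSet hy)⟩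
      | @tail p p' _ hadj ih =>
        obtain ⟨u, v⟩ := p
        obtain ⟨u', v'⟩ := p'
        obtain ⟨⟨hu, hv⟩, ⟨hu', hv'⟩, hne, hS, hor⟩ := hadj
        obtain ⟨-, -, hS0, hlev⟩ := ih
        simp only at hu hv hu' hv' hor hlev
        refine ⟨hu', hv', hS ▸ hS0, ?_⟩
        rcases hor with rfl | rfl
        · exact hlev
        -- For fixed `u`, the equation `S(u, ·) = s` is quadratic, and its roots have product `u³`.
        · have hvv : v' = u ^ 3 / v := by
            rw [stepEval_steps hu hv, stepEval_steps hu hv'] at hS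
            have hne' : v - v' ≠ 0 := fun h => hne (by rw [sub_eq_zero.1 h])
            rw [eq_div_iff hv]
            apply mul_left_cancel₀ hne'
            field_simp at hS
            linear_combination hS
          have hl := linked_of_stepEval hu hv hS0
          rw [← hvv] at hl
          rcases hlev with h | h
          · exact Or.inr (hyz.mem_levelSet h1y hl hv' h)
          · exact Or.inl (hyz.symm.mem_levelSet h1z hl hv' h)
    exact hinv _ h
  · have step : ∀ {a b a' b' : K}, a ≠ 0 → b ≠ 0 → a' ≠ 0 → b' ≠ 0 →
        stepEval steps (a, b) = s → stepEval steps (a', b') = s → (b = b' ∨ a = a') →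
        Relation.ReflTransGen (Adjacent steps) (a, b) (a', b') := by
      intro a b a' b' ha hb ha' hb' h h' hor
      by_cases heq : (a, b) = (a', b')
      · rw [heq]
      · exact Relation.ReflTransGen.single ⟨⟨ha, hb⟩, ⟨ha', hb'⟩, heq, h.trans h'.symm, hor⟩
    -- With `v = a³/b` and `c = linkCoord s y v`, the path is `(x, y)`, `(c, y)`, `(c, v)`, `(a,
    -- v)`, `(a, b)`. Consecutive pairs may coincide, which `step` allows.
    have reach : ∀ {a b : K}, a ≠ 0 → b ≠ 0 → stepEval steps (a, b) = s → b ∈ levelSet y →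
        Relation.ReflTransGen (Adjacent steps) (x, y) (a, b) := by
      intro a b ha hb h hby
      have hv0 : a ^ 3 / b ≠ 0 := div_ne_zero (pow_ne_zero _ ha) hb
      have hv : a ^ 3 / b ∈ levelSet z :=
        hyz.mem_levelSet h1y (linked_of_stepEval ha hb h) hv0 hby
      have h1v := one_add_ne_zero_of_mem_levelSet h1z hv
      have hyv : Linked s y (a ^ 3 / b) := hyz.of_mem_levelSet hy hz0 (self_mem_levelSet hy) hv
      have hc0 : linkCoord s y (a ^ 3 / b) ≠ 0 := by
        unfold linkCoord
        exact div_ne_zero (mul_ne_zero (mul_ne_zero hs0 hy) hv0) (mul_ne_zero h1y h1v)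
      have hS := stepEval_linkCoord hyv hs0 hy hv0 h1y h1v
      have hS' := stepEval_linkCoord hyv.symm hs0 hv0 hy h1v h1y
      rw [linkCoord_comm] at hS'
      exact ((step hx hy hc0 hy hs hS (Or.inl rfl)).trans
        (step hc0 hy hc0 hv0 hS hS' (Or.inr rfl))).trans
        ((step hc0 hv0 ha hv0 hS' (hconj ha hb h) (Or.inl rfl)).trans
        (step ha hv0 ha hb (hconj ha hb h) h (Or.inr rfl)))
    rintro ⟨ha, hb, h, hby | hbz⟩
    · exact reach ha hb h hby
    · have hv0 : a ^ 3 / b ≠ 0 := div_ne_zero (pow_ne_zero _ ha) hb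
      exact (reach ha hv0 (hconj ha hb h) (hyz.symm.mem_levelSet h1z
        (linked_of_stepEval ha hb h) hv0 hbz)).trans
        (step ha hv0 ha hb (hconj ha hb h) h (Or.inr rfl))

theorem ncard_setOf_reflTransGen_adjacent [IsAlgClosed K] [CharZero K] {x y : K} (hx : x ≠ 0)
    (hy : y ≠ 0) (h1y : 1 + y ≠ 0) (h4y : 1 + 4 * y ≠ 0) (h2y : y ≠ 2)
    (h1z : 1 + x ^ 3 / y ≠ 0) (h4z : 1 + 4 * (x ^ 3 / y) ≠ 0) (h2z : x ^ 3 / y ≠ 2)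
    (hyz : x ^ 3 / y ∉ levelSet y) :
    {v | Relation.ReflTransGen (Adjacent steps) (x, y) v}.ncard = 18 := by
  rw [setOf_reflTransGen_adjacent hx hy h1y h1z rfl]
  set z := x ^ 3 / y with hz
  set s := stepEval steps (x, y) with hs
  have hz0 : z ≠ 0 := div_ne_zero (pow_ne_zero _ hx) hy
  have hs0 : s ≠ 0 := by
    rw [hs, stepEval_steps hx hy]
    exact div_ne_zero (mul_ne_zero h1y h1z) (pow_ne_zero _ hx)
  have hlink : Linked s y z := linked_of_stepEval hx hy rfl
  have hcube : ∀ {u v : K}, u ∈ levelSet y → v ∈ levelSet z → linkCoord s u v ^ 3 = u * v :=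
    fun hu hv => linkCoord_pow_three (hlink.of_mem_levelSet hy hz0 hu hv)
      (one_add_ne_zero_of_mem_levelSet h1y hu) (one_add_ne_zero_of_mem_levelSet h1z hv)
  have hc0 : ∀ {u v : K}, u ∈ levelSet y → v ∈ levelSet z → linkCoord s u v ≠ 0 := by
    intro u v hu hv h0
    have := hcube hu hv
    rw [h0] at this
    exact mul_ne_zero hu.1 hv.1 (by rw [← this]; ring)
  have hdisj : ∀ {u : K}, u ∈ levelSet y → u ∉ levelSet z := by
    intro u hu hv
    refine hyz ⟨hz0, ?_⟩
    apply mul_left_cancel₀ (pow_ne_zero 2 hu.1)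
    linear_combination z ^ 2 * hu.2 - y ^ 2 * hv.2
  have key : {p : K × K | p.1 ≠ 0 ∧ p.2 ≠ 0 ∧ stepEval steps p = s ∧
        (p.2 ∈ levelSet y ∨ p.2 ∈ levelSet z)} =
      (fun p : K × K => (linkCoord s p.1 p.2, p.1)) '' (levelSet y ×ˢ levelSet z) ∪
      (fun p : K × K => (linkCoord s p.1 p.2, p.2)) '' (levelSet y ×ˢ levelSet z) := by
    ext ⟨a, b⟩
    simp only [Set.mem_ofPred_eq, Set.mem_union, Set.mem_image, Set.mem_prod, Prod.exists,
      Prod.mk.injEq]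
    constructor
    · rintro ⟨ha, hb, h, hby | hbz⟩
      · exact Or.inl ⟨b, a ^ 3 / b, ⟨hby, hlink.mem_levelSet h1y (linked_of_stepEval ha hb h)
          (div_ne_zero (pow_ne_zero _ ha) hb) hby⟩, linkCoord_eq ha hb hs0 h, rfl⟩
      · exact Or.inr ⟨a ^ 3 / b, b, ⟨hlink.symm.mem_levelSet h1z (linked_of_stepEval ha hb h)
          (div_ne_zero (pow_ne_zero _ ha) hb) hbz, hbz⟩,
          by rw [linkCoord_comm]; exact linkCoord_eq ha hb hs0 h, rfl⟩
    · rintro (⟨u, v, ⟨hu, hv⟩, rfl, rfl⟩ | ⟨u, v, ⟨hu, hv⟩, rfl, rfl⟩)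
      · exact ⟨hc0 hu hv, hu.1, stepEval_linkCoord (hlink.of_mem_levelSet hy hz0 hu hv) hs0 hu.1
          hv.1 (one_add_ne_zero_of_mem_levelSet h1y hu) (one_add_ne_zero_of_mem_levelSet h1z hv),
          Or.inl hu⟩
      · refine ⟨hc0 hu hv, hv.1, ?_, Or.inr hv⟩
        rw [linkCoord_comm]
        exact stepEval_linkCoord (hlink.of_mem_levelSet hy hz0 hu hv).symm hs0 hv.1
          hu.1 (one_add_ne_zero_of_mem_levelSet h1z hv) (one_add_ne_zero_of_mem_levelSet h1y hu)
  have hY := ncard_levelSet hy h1y h4y h2y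
  have hZ := ncard_levelSet hz0 h1z h4z h2z
  have hfin : (levelSet y ×ˢ levelSet z).Finite :=
    (Set.finite_of_ncard_ne_zero (by rw [hY]; norm_num)).prod
      (Set.finite_of_ncard_ne_zero (by rw [hZ]; norm_num))
  rw [key, Set.ncard_union_eq _ (hfin.image _) (hfin.image _), Set.InjOn.ncard_image,
    Set.InjOn.ncard_image, Set.ncard_prod, hY, hZ]
  -- An image pair shows one of `u`, `v`; the cube of its first coordinate is `uv`, which recovers
  -- the other.
  · rintro ⟨u, v⟩ ⟨hu, hv⟩ ⟨u', v'⟩ ⟨hu', hv'⟩ h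
    simp only [Prod.mk.injEq] at h hu hv hu' hv' ⊢
    obtain ⟨h, rfl⟩ := h
    refine ⟨mul_right_cancel₀ hv.1 ?_, rfl⟩
    rw [← hcube hu hv, ← hcube hu' hv', h]
  · rintro ⟨u, v⟩ ⟨hu, hv⟩ ⟨u', v'⟩ ⟨hu', hv'⟩ h
    simp only [Prod.mk.injEq] at h hu hv hu' hv' ⊢
    obtain ⟨h, rfl⟩ := h
    refine ⟨rfl, mul_left_cancel₀ hu.1 ?_⟩
    rw [← hcube hu hv, ← hcube hu' hv', h]
  · rw [Set.disjoint_left]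
    rintro _ ⟨⟨u, v⟩, ⟨hu, hv⟩, rfl⟩ ⟨⟨u', v'⟩, ⟨hu', hv'⟩, h⟩
    simp only [Prod.mk.injEq] at h hu hv hu' hv'
    exact hdisj hu (h.2 ▸ hv')

end Orbit

/-- Each genericity condition on `(x, y)` is the non-vanishing of a polynomial, so one numerical
point certifies it. -/
theorem aeval_genericPair_ne_zero {p : MvPolynomial (Fin 2) ℂ} (a : Fin 2 → ℂ)
    (hp : MvPolynomial.eval a p ≠ 0) :
    algebraMap RatField RatClosure (algebraMap (MvPolynomial (Fin 2) ℂ) RatField p) ≠ 0 := by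
  rw [ne_eq, map_eq_zero_iff _ (algebraMap RatField RatClosure).injective,
    map_eq_zero_iff _ (IsFractionRing.injective (MvPolynomial (Fin 2) ℂ) RatField)]
  rintro rfl
  simp at hp

theorem ncard_orbit_steps : (orbit steps).ncard = 18 := by
  have hgen := fun (p : MvPolynomial (Fin 2) ℂ) => aeval_genericPair_ne_zero (p := p)
  unfold orbit genericPair
  set x := algebraMap RatField RatClosure (algebraMap (MvPolynomial (Fin 2) ℂ) RatField
    (MvPolynomial.X 0)) with hx
  set y := algebraMap RatField RatClosure (algebraMap (MvPolynomial (Fin 2) ℂ) RatField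
    (MvPolynomial.X 1)) with hy
  have h1 := hgen (MvPolynomial.X 0) ![1, 1] (by simp)
  have h2 := hgen (MvPolynomial.X 1) ![1, 1] (by simp)
  have h3 := hgen (1 + MvPolynomial.X 1) ![1, 1] (by simp)
  have h4 := hgen (1 + 4 * MvPolynomial.X 1) ![1, 1] (by simp; norm_num)
  have h5 := hgen (MvPolynomial.X 1 - 2) ![1, 1] (by simp; norm_num)
  have h6 := hgen (MvPolynomial.X 1 + MvPolynomial.X 0 ^ 3) ![1, 1] (by simp)
  have h7 := hgen (MvPolynomial.X 1 + 4 * MvPolynomial.X 0 ^ 3) ![1, 1] (by simp; norm_num)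
  have h8 := hgen (MvPolynomial.X 0 ^ 3 - 2 * MvPolynomial.X 1) ![1, 1] (by simp; norm_num)
  -- The point `(1, 1)` would fail here, since `x³/y = y` there.
  have h9 := hgen ((MvPolynomial.X 1 + MvPolynomial.X 0 ^ 3) ^ 3 * MvPolynomial.X 1 -
    (1 + MvPolynomial.X 1) ^ 3 * MvPolynomial.X 0 ^ 6) ![1, 2] (by simp; norm_num)
  simp only [map_add, map_sub, map_mul, map_pow, map_one, map_ofNat, ← hx, ← hy]
    at h1 h2 h3 h4 h5 h6 h7 h8 h9
  apply ncard_setOf_reflTransGen_adjacent h1 h2 h3 h4 (sub_ne_zero.1 h5)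
  · intro h; apply h6; field_simp at h; linear_combination h
  · intro h; apply h7; field_simp at h; linear_combination h
  · intro h; apply h8; field_simp at h; linear_combination h
  · rintro ⟨-, h⟩
    apply h9; field_simp at h; linear_combination h

/-! ### Recursion on the last step -/

/-- The number of `n`-step quadrant walks that end at `p`. -/
def walkCount (S : Finset (ℤ × ℤ)) (p : ℤ × ℤ) (n : ℕ) : ℕ :=
  ((walks S n).filter fun w => endpoint w = p).card

theorem position_snoc {n : ℕ} (w : Fin n → ℤ × ℤ) (s : ℤ × ℤ) {m : ℕ} (hm : m ≤ n) :
    position (Fin.snoc w s : Fin (n + 1) → ℤ × ℤ) m = position w m := by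
  simp only [position, Finset.sum_filter, Fin.sum_univ_castSucc, Fin.snoc_castSucc,
    Fin.val_castSucc, Fin.val_last]
  rw [if_neg (by omega), add_zero]

theorem position_eq_endpoint {n : ℕ} (w : Fin n → ℤ × ℤ) : position w n = endpoint w := by
  simp [position, endpoint]

theorem endpoint_snoc {n : ℕ} (w : Fin n → ℤ × ℤ) (s : ℤ × ℤ) :
    endpoint (Fin.snoc w s : Fin (n + 1) → ℤ × ℤ) = endpoint w + s := by
  simp [endpoint, Fin.sum_univ_castSucc]

theorem snoc_mem_walks {S : Finset (ℤ × ℤ)} {n : ℕ} (w : Fin n → ℤ × ℤ) (s : ℤ × ℤ) :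
    (Fin.snoc w s : Fin (n + 1) → ℤ × ℤ) ∈ walks S (n + 1) ↔
      w ∈ walks S n ∧ s ∈ S ∧ 0 ≤ (endpoint w + s).1 ∧ 0 ≤ (endpoint w + s).2 := by
  have hlast : position (Fin.snoc w s : Fin (n + 1) → ℤ × ℤ) (n + 1) = endpoint w + s := by
    rw [position_eq_endpoint, endpoint_snoc]
  simp only [walks, Finset.mem_filter, Fintype.mem_piFinset, Fin.forall_fin_succ' (n := n + 1),
    Fin.val_castSucc, Fin.val_last, hlast]
  simp only [Fin.forall_fin_succ' (n := n) (P := fun a => (Fin.snoc w s : Fin (n + 1) → ℤ × ℤ) a ∈ S),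
    Fin.snoc_castSucc, Fin.snoc_last]
  have h : ∀ m : Fin (n + 1), position (Fin.snoc w s : Fin (n + 1) → ℤ × ℤ) m = position w m :=
    fun m => position_snoc w s (Nat.lt_succ_iff.1 m.2)
  simp only [h]
  tauto

theorem endpoint_nonneg {S : Finset (ℤ × ℤ)} {n : ℕ} {w : Fin n → ℤ × ℤ} (hw : w ∈ walks S n) :
    0 ≤ (endpoint w).1 ∧ 0 ≤ (endpoint w).2 := by
  have := (Finset.mem_filter.1 hw).2 (Fin.last n)
  rwa [Fin.val_last, position_eq_endpoint] at this

theorem walkCount_eq_zero {S : Finset (ℤ × ℤ)} {p : ℤ × ℤ} (n : ℕ) (hp : ¬(0 ≤ p.1 ∧ 0 ≤ p.2)) :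
    walkCount S p n = 0 := by
  rw [walkCount, Finset.card_eq_zero, Finset.filter_eq_empty_iff]
  rintro w hw rfl
  exact hp (endpoint_nonneg hw)

theorem walkCount_zero (S : Finset (ℤ × ℤ)) (p : ℤ × ℤ) :
    walkCount S p 0 = if p = 0 then 1 else 0 := by
  have : walks S 0 = {Fin.elim0} := by
    ext w
    simp only [walks, position, Finset.univ_eq_empty, Finset.filter_empty, Finset.sum_empty,
      Finset.mem_filter, Fintype.mem_piFinset, IsEmpty.forall_iff, Finset.mem_singleton]
    simp [Subsingleton.elim w Fin.elim0]
  rw [walkCount, this, Finset.filter_singleton]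
  simp [endpoint, eq_comm, apply_ite Finset.card]

theorem walkCount_succ (S : Finset (ℤ × ℤ)) {p : ℤ × ℤ} (n : ℕ) (hp : 0 ≤ p.1 ∧ 0 ≤ p.2) :
    walkCount S p (n + 1) = ∑ s ∈ S, walkCount S (p - s) n := by
  rw [walkCount, Finset.card_eq_sum_card_fiberwise (f := fun w => w (Fin.last n)) (t := S)]
  · refine Finset.sum_congr rfl fun s hs => ?_
    refine Finset.card_nbij' (fun w => Fin.init w) (fun w => Fin.snoc w s) ?_ ?_ ?_ ?_
    · intro w hw
      simp only [Finset.coe_filter, Finset.mem_filter, Set.mem_ofPred_eq] at hw ⊢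
      obtain ⟨⟨hw, he⟩, rfl⟩ := hw
      rw [← Fin.snoc_init_self w] at hw he
      rw [snoc_mem_walks] at hw
      rw [endpoint_snoc] at he
      exact ⟨hw.1, eq_sub_of_add_eq he⟩
    · intro w hw
      simp only [Finset.coe_filter, Finset.mem_filter, Set.mem_ofPred_eq] at hw ⊢
      obtain ⟨hw, he⟩ := hw
      have he' : endpoint w + s = p := by rw [he, sub_add_cancel]
      rw [snoc_mem_walks, endpoint_snoc, he']
      exact ⟨⟨⟨hw, hs, hp⟩, rfl⟩, Fin.snoc_last _ _⟩
    · intro w hw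
      simp only [Finset.coe_filter, Finset.mem_filter, Set.mem_ofPred_eq] at hw
      obtain ⟨_, rfl⟩ := hw
      exact Fin.snoc_init_self w
    · intro w _
      exact Fin.init_snoc _ _
  · intro w hw
    simp only [Finset.coe_filter, Set.mem_ofPred_eq] at hw
    exact Fintype.mem_piFinset.1 (Finset.mem_filter.1 hw.1).1 _

theorem sum_steps {M : Type*} [AddCommMonoid M] (f : ℤ × ℤ → M) :
    ∑ s ∈ steps, f s = f (1, 0) + f (1, -1) + f (-2, 1) + f (-2, 0) := by
  rw [steps, Finset.sum_insert (by decide), Finset.sum_insert (by decide),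
    Finset.sum_insert (by decide), Finset.sum_singleton, add_assoc, add_assoc]

/-! ### The closed form -/

/-- `1 / z!`, extended by zero to negative integers. -/
def invFactorial (z : ℤ) : ℚ := if 0 ≤ z then 1 / (z.toNat ! : ℚ) else 0

theorem invFactorial_natCast (n : ℕ) : invFactorial n = 1 / (n ! : ℚ) := by
  simp [invFactorial]

theorem invFactorial_of_neg {z : ℤ} (h : z < 0) : invFactorial z = 0 := if_neg (not_le.2 h)

/-- The recurrence survives the extension by zero because `z + 1` vanishes at `z = -1`. Identities
built on it therefore need no sign conditions and cover boundary terms. -/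
theorem invFactorial_eq (z : ℤ) : invFactorial z = (z + 1) * invFactorial (z + 1) := by
  rcases lt_trichotomy z (-1) with h | rfl | h
  · rw [invFactorial_of_neg (by omega), invFactorial_of_neg (by omega), mul_zero]
  · rw [invFactorial_of_neg (by omega)]; simp
  · lift z to ℕ using by omega
    rw [← Nat.cast_succ, invFactorial_natCast, invFactorial_natCast, Nat.factorial_succ]
    push_cast
    field_simp

theorem invFactorial_eq_of_eq_add_one {z w : ℤ} (h : w = z + 1) :
    invFactorial z = w * invFactorial w := by
  rw [invFactorial_eq z, h]; push_cast; rfl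

/-- The closed form of `q(i, j; n)`, where `n = i + 3 j + 3 m`. -/
def closedForm (i j m : ℤ) (n : ℕ) : ℚ :=
  (i + 1) * (j + 1) * (i + 3 * j + 4) *
    ((i + 2 * j + 2) * (i + 2 * j + 3) + m * (2 * i + 3 * j + 4)) * n ! * (n + 3)! *
    invFactorial m * invFactorial (m + j + 1) * invFactorial (2 * m + i + 2 * j + 3) *
    invFactorial (2 * m + i + 3 * j + 4)

/-- After the inverse factorials are reduced to four common ones and `n` is eliminated, a polynomial
identity in `i`, `j`, `m` remains. -/
theorem closedForm_succ {i j m : ℤ} {n : ℕ} (h : (n : ℤ) + 1 = i + 3 * j + 3 * m) :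
    closedForm i j m (n + 1) = closedForm (i - 1) j m n + closedForm (i - 1) (j + 1) (m - 1) n +
      closedForm (i + 2) (j - 1) m n + closedForm (i + 2) j (m - 1) n := by
  have hn : (n : ℚ) = i + 3 * j + 3 * m - 1 := by
    have : ((n : ℤ) : ℚ) = ((i + 3 * j + 3 * m - 1 : ℤ) : ℚ) := by congr 1; omega
    push_cast at this; exact this
  have e1 : invFactorial (m - 1) = (m : ℤ) * invFactorial m :=
    invFactorial_eq_of_eq_add_one (by ring)
  have e2 : invFactorial (m + j) = (m + j + 1 : ℤ) * invFactorial (m + j + 1) :=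
    invFactorial_eq_of_eq_add_one (by ring)
  have e3 : invFactorial (2 * m + i + 2 * j + 2) =
      (2 * m + i + 2 * j + 3 : ℤ) * invFactorial (2 * m + i + 2 * j + 3) :=
    invFactorial_eq_of_eq_add_one (by ring)
  have e4 : invFactorial (2 * m + i + 3 * j + 3) =
      (2 * m + i + 3 * j + 4 : ℤ) * invFactorial (2 * m + i + 3 * j + 4) :=
    invFactorial_eq_of_eq_add_one (by ring)
  simp only [closedForm]
  rw [show m - 1 + (j + 1) + 1 = m + j + 1 by ring, show m + (j - 1) + 1 = m + j by ring,
    show m - 1 + j + 1 = m + j by ring,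
    show 2 * m + (i - 1) + 2 * j + 3 = 2 * m + i + 2 * j + 2 by ring,
    show 2 * m + (i - 1) + 3 * j + 4 = 2 * m + i + 3 * j + 3 by ring,
    show 2 * (m - 1) + (i - 1) + 2 * (j + 1) + 3 = 2 * m + i + 2 * j + 2 by ring,
    show 2 * (m - 1) + (i - 1) + 3 * (j + 1) + 4 = 2 * m + i + 3 * j + 4 by ring,
    show 2 * m + (i + 2) + 2 * (j - 1) + 3 = 2 * m + i + 2 * j + 3 by ring,
    show 2 * m + (i + 2) + 3 * (j - 1) + 4 = 2 * m + i + 3 * j + 3 by ring,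
    show 2 * (m - 1) + (i + 2) + 2 * j + 3 = 2 * m + i + 2 * j + 3 by ring,
    show 2 * (m - 1) + (i + 2) + 3 * j + 4 = 2 * m + i + 3 * j + 4 by ring,
    e1, e2, e3, e4, show n + 1 + 3 = n + 3 + 1 by ring, Nat.factorial_succ n,
    Nat.factorial_succ (n + 3)]
  push_cast
  rw [hn]
  ring

theorem closedForm_neg_one_left (j m : ℤ) (n : ℕ) : closedForm (-1) j m n = 0 := by
  simp [closedForm]

theorem closedForm_neg_one_right (i m : ℤ) (n : ℕ) : closedForm i (-1) m n = 0 := by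
  simp [closedForm]

/-- From the quadrant, the recursion reaches back at most to the lines `i = -1` and `j = -1`. Both
sides vanish there, so the range `≥ -1` makes the induction close. -/
theorem walkCount_steps (n : ℕ) : ∀ i j : ℤ, -1 ≤ i → -1 ≤ j →
    (∀ m : ℤ, (n : ℤ) = i + 3 * j + 3 * m → (walkCount steps (i, j) n : ℚ) = closedForm i j m n) ∧
    ((∀ m : ℤ, (n : ℤ) ≠ i + 3 * j + 3 * m) → walkCount steps (i, j) n = 0) := by
  induction n with
  | zero =>
    intro i j hi hj
    rcases hi.eq_or_lt with rfl | hi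
    · exact ⟨fun m _ => by rw [closedForm_neg_one_left, walkCount_eq_zero _ (by simp)]; simp,
        fun _ => walkCount_eq_zero _ (by simp)⟩
    rcases hj.eq_or_lt with rfl | hj
    · exact ⟨fun m _ => by rw [closedForm_neg_one_right, walkCount_eq_zero _ (by simp)]; simp,
        fun _ => walkCount_eq_zero _ (by simp)⟩
    constructor
    · intro m hm
      rw [walkCount_zero]
      split_ifs with h
      · rw [Prod.mk_eq_zero] at h
        obtain ⟨rfl, rfl⟩ := h
        obtain rfl : m = 0 := by omega
        norm_num [closedForm, invFactorial, Nat.factorial, show Int.toNat 3 = 3 from rfl,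
          show Int.toNat 4 = 4 from rfl]
      -- The point is in the quadrant and is not the origin, so `0 = i + 3j + 3m` forces `m < 0`,
      -- and `invFactorial m` vanishes.
      · have : m < 0 := by
          rw [Prod.mk_eq_zero] at h
          omega
        rw [closedForm, invFactorial_of_neg this]
        simp
    · intro h
      rw [walkCount_zero, if_neg]
      rintro h0
      rw [Prod.mk_eq_zero] at h0
      exact h 0 (by simp [h0])
  | succ n ih =>
    intro i j hi hj
    rcases hi.eq_or_lt with rfl | hi
    · exact ⟨fun m _ => by rw [closedForm_neg_one_left, walkCount_eq_zero _ (by simp)]; simp,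
        fun _ => walkCount_eq_zero _ (by simp)⟩
    rcases hj.eq_or_lt with rfl | hj
    · exact ⟨fun m _ => by rw [closedForm_neg_one_right, walkCount_eq_zero _ (by simp)]; simp,
        fun _ => walkCount_eq_zero _ (by simp)⟩
    rw [walkCount_succ _ _ (by constructor <;> simp <;> omega), sum_steps]
    simp only [Prod.mk_sub_mk, sub_zero, sub_neg_eq_add]
    have h1 := ih (i - 1) j (by omega) (by omega)
    have h2 := ih (i - 1) (j + 1) (by omega) (by omega)
    have h3 := ih (i + 2) (j - 1) (by omega) (by omega)
    have h4 := ih (i + 2) j (by omega) (by omega)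
    constructor
    · intro m hm
      push_cast at hm
      rw [closedForm_succ hm, ← h1.1 m (by omega), ← h2.1 (m - 1) (by omega),
        ← h3.1 m (by omega), ← h4.1 (m - 1) (by omega)]
      push_cast
      rfl
    · intro h
      push_cast at h
      rw [h1.2 fun m hm => h m (by omega), h2.2 fun m hm => h (m + 1) (by omega),
        h3.2 fun m hm => h m (by omega), h4.2 fun m hm => h (m + 1) (by omega)]

theorem q_eq_walkCount (S : Finset (ℤ × ℤ)) (i j n : ℕ) : q S i j n = walkCount S (i, j) n := rfl

theorem q_steps_eq_zero {i j n : ℕ} (h : ∀ m : ℕ, n ≠ i + 3 * j + 3 * m) : q steps i j n = 0 := by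
  obtain ⟨h1, h2⟩ := walkCount_steps n i j (by omega) (by omega)
  rw [q_eq_walkCount]
  by_cases hex : ∃ m : ℤ, (n : ℤ) = i + 3 * j + 3 * m
  · obtain ⟨m, hm⟩ := hex
    have hneg : m < 0 := by
      by_contra hm0
      lift m to ℕ using by omega
      exact h m (by omega)
    have := h1 m hm
    rw [closedForm, invFactorial_of_neg hneg] at this
    simpa using this
  · exact h2 fun m hm => hex ⟨m, hm⟩

theorem q_steps_eq {i j m n : ℕ} (h : n = i + 3 * j + 3 * m) :
    (q steps i j n : ℚ) =
        ((i + 1) * (j + 1) * (i + 3 * j + 4) *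
            ((i + 2 * j + 2) * (i + 2 * j + 3) + m * (2 * i + 3 * j + 4)) * n ! * (n + 3)!) /
          (m ! * (m + j + 1)! * (2 * m + i + 2 * j + 3)! * (2 * m + i + 3 * j + 4)!) := by
  rw [q_eq_walkCount, (walkCount_steps n i j (by omega) (by omega)).1 m (by omega), closedForm]
  have e2 := invFactorial_natCast (m + j + 1)
  have e3 := invFactorial_natCast (2 * m + i + 2 * j + 3)
  have e4 := invFactorial_natCast (2 * m + i + 3 * j + 4)
  push_cast at e2 e3 e4
  rw [invFactorial_natCast, e2, e3, e4]
  push_cast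
  field_simp

/-! ### The non-negative part -/

theorem mono_mul_mono (s t : ℤ × ℤ) : mono s * mono t = mono (s + t) := by
  simp [mono, AddMonoidAlgebra.single_mul_single]

theorem mono_zero : mono 0 = 1 := rfl

theorem mono_pow (s : ℤ × ℤ) (n : ℕ) : mono s ^ n = mono (n • s) := by
  simp [mono, AddMonoidAlgebra.single_pow]

theorem x_pow_mul_y_pow (a b : ℕ) : x ^ a * y ^ b = mono (a, b) := by
  simp [x, y, mono_pow, mono_mul_mono]

theorem coeff_mono_mul (s p : ℤ × ℤ) (f : Laurent) :
    (mono s * f).coeff p = f.coeff (p - s) := by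
  rw [mono, AddMonoidAlgebra.coeff_single_mul_apply, one_mul, neg_add_eq_sub]

theorem coeff_stepPoly_pow_succ (n : ℕ) (p : ℤ × ℤ) :
    (stepPoly steps ^ (n + 1)).coeff p = ∑ s ∈ steps, (stepPoly steps ^ n).coeff (p - s) := by
  rw [pow_succ', stepPoly, Finset.sum_mul, AddMonoidAlgebra.coeff_sum, Finsupp.finsetSum_apply]
  simp only [coeff_mono_mul]

/-- By `S = (1 + 1/y)(x + y/x²)`, choosing `x` in `k` factors and `1` in `l` factors gives the
monomial `x^(3k - 2n) y^(l - k)`, with coefficient `C(n, k) C(n, l)`. -/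
theorem coeff_stepPoly_pow (n : ℕ) : ∀ k l : ℤ,
    (stepPoly steps ^ n).coeff (3 * k - 2 * n, l - k) = (n ! : ℚ) ^ 2 * invFactorial k *
      invFactorial (n - k) * invFactorial l * invFactorial (n - l) := by
  induction n with
  | zero =>
    intro k l
    rw [pow_zero, ← mono_zero, mono, AddMonoidAlgebra.coeff_single, Finsupp.single_apply]
    split_ifs with h
    · simp only [Prod.ext_iff, Prod.fst_zero, Prod.snd_zero] at h
      obtain rfl : k = 0 := by omega
      obtain rfl : l = 0 := by omega
      simp [invFactorial]
    · have hkl : k ≠ 0 ∨ l ≠ 0 := by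
        by_contra! h0
        exact h (by simp [h0, Prod.ext_iff])
      have hzero : ∀ z : ℤ, z ≠ 0 → invFactorial z * invFactorial (0 - z) = 0 := by
        intro z hz
        rcases lt_or_gt_of_ne hz with h | h
        · rw [invFactorial_of_neg h, zero_mul]
        · rw [invFactorial_of_neg (z := 0 - z) (by omega), mul_zero]
      rcases hkl with h | h
      · linear_combination -invFactorial l * invFactorial (0 - l) * hzero k h
      · linear_combination -invFactorial k * invFactorial (0 - k) * hzero l h
  | succ n ih =>
    intro k l
    have e : ∀ z : ℤ, invFactorial (z - 1) = z * invFactorial z :=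
      fun z => invFactorial_eq_of_eq_add_one (by ring)
    have e' : ∀ z : ℤ, invFactorial (n - z) = (n + 1 - z) * invFactorial (n + 1 - z) := by
      intro z
      rw [invFactorial_eq_of_eq_add_one (w := n + 1 - z) (by ring)]
      push_cast
      ring
    rw [coeff_stepPoly_pow_succ, sum_steps]
    simp only [Prod.mk_sub_mk]
    rw [show ((3 * k - 2 * ((n + 1 : ℕ) : ℤ) - 1, l - k - 0) : ℤ × ℤ) =
        (3 * (k - 1) - 2 * n, (l - 1) - (k - 1)) by ext <;> push_cast <;> ring,
      show ((3 * k - 2 * ((n + 1 : ℕ) : ℤ) - 1, l - k - -1) : ℤ × ℤ) =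
        (3 * (k - 1) - 2 * n, l - (k - 1)) by ext <;> push_cast <;> ring,
      show ((3 * k - 2 * ((n + 1 : ℕ) : ℤ) - -2, l - k - 1) : ℤ × ℤ) =
        (3 * k - 2 * n, (l - 1) - k) by ext <;> push_cast <;> ring,
      show ((3 * k - 2 * ((n + 1 : ℕ) : ℤ) - -2, l - k - 0) : ℤ × ℤ) =
        (3 * k - 2 * n, l - k) by ext <;> push_cast <;> ring, ih, ih, ih, ih,
      show (n : ℤ) - (k - 1) = n + 1 - k by ring, show (n : ℤ) - (l - 1) = n + 1 - l by ring,
      e, e, e', e', Nat.factorial_succ]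
    push_cast
    ring

theorem coeff_stepPoly_pow_eq_zero (n : ℕ) : ∀ i j : ℤ, (∀ k : ℤ, i ≠ 3 * k - 2 * n) →
    (stepPoly steps ^ n).coeff (i, j) = 0 := by
  induction n with
  | zero =>
    intro i j h
    rw [pow_zero, ← mono_zero, mono, AddMonoidAlgebra.coeff_single, Finsupp.single_apply, if_neg]
    intro h0
    rw [eq_comm, Prod.mk_eq_zero] at h0
    exact h 0 (by simp [h0])
  | succ n ih =>
    intro i j h
    push_cast at h
    rw [coeff_stepPoly_pow_succ, sum_steps]
    simp only [Prod.mk_sub_mk]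
    rw [ih _ _ fun k hk => h (k + 1) (by omega), ih _ _ fun k hk => h (k + 1) (by omega),
      ih _ _ fun k hk => h k (by omega), ih _ _ fun k hk => h k (by omega)]
    simp

theorem invFactorial_sub (w : ℤ) (d : ℕ) :
    invFactorial (w - d) = (∏ t ∈ Finset.range d, ((w : ℚ) - t)) * invFactorial w := by
  induction d with
  | zero => simp
  | succ d ih =>
    rw [Finset.prod_range_succ, invFactorial_eq_of_eq_add_one (w := w - d) (by push_cast; ring), ih]
    push_cast
    ring

/-- The numerator of the generating function. -/
def numerator : Laurent :=
  (2 - y) * (x ^ 3 - y ^ 2) * (x ^ 6 * y - 3 * x ^ 3 * y - x ^ 3 - y ^ 2) * (x ^ 3 - 2 * y)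

theorem mono_mul_numerator : mono (-9, -4) * numerator =
    (-1 : ℚ) • mono (3, -2) + (2 : ℚ) • mono (3, -3) + (1 : ℚ) • mono (0, 0) +
    (-1 : ℚ) • mono (0, -2) + (-5 : ℚ) • mono (0, -3) + (-2 : ℚ) • mono (0, -4) +
    (-2 : ℚ) • mono (-3, 1) + (1 : ℚ) • mono (-3, 0) + (10 : ℚ) • mono (-3, -2) +
    (4 : ℚ) • mono (-3, -3) + (5 : ℚ) • mono (-6, 1) + (-10 : ℚ) • mono (-6, 0) +
    (2 : ℚ) • mono (-9, 2) + (-4 : ℚ) • mono (-9, 1) := by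
  have h : numerator =
      (-1) * (x ^ 12 * y ^ 2) + 2 * (x ^ 12 * y ^ 1) + 1 * (x ^ 9 * y ^ 4) +
      (-1) * (x ^ 9 * y ^ 2) + (-5) * (x ^ 9 * y ^ 1) + (-2) * (x ^ 9 * y ^ 0) +
      (-2) * (x ^ 6 * y ^ 5) + 1 * (x ^ 6 * y ^ 4) + 10 * (x ^ 6 * y ^ 2) + 4 * (x ^ 6 * y ^ 1) +
      5 * (x ^ 3 * y ^ 5) + (-10) * (x ^ 3 * y ^ 4) + 2 * (x ^ 0 * y ^ 6) + (-4) * (x ^ 0 * y ^ 5) := by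
    unfold numerator; ring
  rw [h]
  simp only [mul_add, x_pow_mul_y_pow, mul_left_comm (mono (-9, -4)), mono_mul_mono,
    Prod.mk_add_mk]
  simp only [Algebra.smul_def, map_neg, map_ofNat, map_one]
  norm_num

theorem coeff_numerator_mul (n : ℕ) (i j : ℤ) :
    letI c := fun a b : ℤ => (stepPoly steps ^ n).coeff (i - a, j - b)
    (mono (-9, -4) * numerator * stepPoly steps ^ n).coeff (i, j) =
      (-1) * c (3) (-2) + 2 * c (3) (-3) + 1 * c (0) (0) + (-1) * c (0) (-2) + (-5) * c (0) (-3) +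
      (-2) * c (0) (-4) + (-2) * c (-3) (1) + 1 * c (-3) (0) + 10 * c (-3) (-2) + 4 * c (-3) (-3) +
      5 * c (-6) (1) + (-10) * c (-6) (0) + 2 * c (-9) (2) + (-4) * c (-9) (1) := by
  rw [mono_mul_numerator]
  simp only [add_mul, smul_mul_assoc, AddMonoidAlgebra.coeff_add, AddMonoidAlgebra.coeff_smul,
    Finsupp.add_apply, Finsupp.smul_apply, coeff_mono_mul, smul_eq_mul, Prod.mk_sub_mk]

/-- All monomials of the expanded numerator are brought to the inverse factorials of the closed
form. The shifts `d₁`, …, `d₄` are the amounts by which the four factorial arguments drop; they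
leave falling factorials, so that only a polynomial identity has to be checked. -/
theorem coeff_stepPoly_pow_sub {i j m : ℤ} {n : ℕ} (h : (n : ℤ) = i + 3 * j + 3 * m) (a b : ℤ)
    (d₁ d₂ d₃ d₄ : ℕ) (h₁ : a = 3 * (d₁ - 3)) (h₂ : (d₁ + d₂ : ℤ) = 4)
    (h₃ : (d₃ : ℤ) = 1 + d₁ + b) (h₄ : (d₃ + d₄ : ℤ) = 4) :
    (stepPoly steps ^ n).coeff (i - a, j - b) = (n ! : ℚ) ^ 2 *
      ((∏ t ∈ Finset.range d₁, (2 * m + i + 2 * j + 3 - t : ℚ)) *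
      (∏ t ∈ Finset.range d₂, (m + j + 1 - t : ℚ)) *
      (∏ t ∈ Finset.range d₃, (2 * m + i + 3 * j + 4 - t : ℚ)) *
      (∏ t ∈ Finset.range d₄, (m - t : ℚ))) *
      (invFactorial m * invFactorial (m + j + 1) * invFactorial (2 * m + i + 2 * j + 3) *
        invFactorial (2 * m + i + 3 * j + 4)) := by
  have e₁ := invFactorial_sub (2 * m + i + 2 * j + 3) d₁
  have e₂ := invFactorial_sub (m + j + 1) d₂
  have e₃ := invFactorial_sub (2 * m + i + 3 * j + 4) d₃
  have e₄ := invFactorial_sub m d₄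
  push_cast at e₁ e₂ e₃ e₄
  have hk := coeff_stepPoly_pow n (2 * m + i + 2 * j + 3 - d₁) (2 * m + i + 3 * j + 4 - d₃)
  rw [show (n : ℤ) - (2 * m + i + 2 * j + 3 - d₁) = m + j + 1 - d₂ by omega,
    show (n : ℤ) - (2 * m + i + 3 * j + 4 - d₃) = m - d₄ by omega, e₁, e₂, e₃, e₄] at hk
  rw [show ((i - a, j - b) : ℤ × ℤ) = (3 * (2 * m + i + 2 * j + 3 - d₁) - 2 * n,
      2 * m + i + 3 * j + 4 - d₃ - (2 * m + i + 2 * j + 3 - d₁)) by ext <;> simp only <;> omega, hk]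
  ring

theorem coeff_numerator_mul_eq_closedForm {i j m : ℤ} {n : ℕ} (h : (n : ℤ) = i + 3 * j + 3 * m) :
    (mono (-9, -4) * numerator * stepPoly steps ^ n).coeff (i, j) = closedForm i j m n := by
  have hn : (n : ℚ) = i + 3 * j + 3 * m := by exact_mod_cast congrArg (Int.cast : ℤ → ℚ) h
  have hc := coeff_stepPoly_pow_sub h
  rw [coeff_numerator_mul]
  beta_reduce
  rw [hc (3) (-2) 4 0 3 1 (by norm_num) (by norm_num) (by norm_num) (by norm_num),
    hc (3) (-3) 4 0 2 2 (by norm_num) (by norm_num) (by norm_num) (by norm_num),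
    hc (0) (0) 3 1 4 0 (by norm_num) (by norm_num) (by norm_num) (by norm_num),
    hc (0) (-2) 3 1 2 2 (by norm_num) (by norm_num) (by norm_num) (by norm_num),
    hc (0) (-3) 3 1 1 3 (by norm_num) (by norm_num) (by norm_num) (by norm_num),
    hc (0) (-4) 3 1 0 4 (by norm_num) (by norm_num) (by norm_num) (by norm_num),
    hc (-3) (1) 2 2 4 0 (by norm_num) (by norm_num) (by norm_num) (by norm_num),
    hc (-3) (0) 2 2 3 1 (by norm_num) (by norm_num) (by norm_num) (by norm_num),
    hc (-3) (-2) 2 2 1 3 (by norm_num) (by norm_num) (by norm_num) (by norm_num),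
    hc (-3) (-3) 2 2 0 4 (by norm_num) (by norm_num) (by norm_num) (by norm_num),
    hc (-6) (1) 1 3 3 1 (by norm_num) (by norm_num) (by norm_num) (by norm_num),
    hc (-6) (0) 1 3 2 2 (by norm_num) (by norm_num) (by norm_num) (by norm_num),
    hc (-9) (2) 0 4 3 1 (by norm_num) (by norm_num) (by norm_num) (by norm_num),
    hc (-9) (1) 0 4 2 2 (by norm_num) (by norm_num) (by norm_num) (by norm_num)]
  simp only [Finset.prod_range_succ, Finset.prod_range_zero, closedForm, Nat.factorial_succ]
  push_cast
  rw [hn]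
  ring

theorem coeff_numerator_mul_eq_zero {i j : ℤ} {n : ℕ} (h : ∀ m : ℤ, (n : ℤ) ≠ i + 3 * j + 3 * m) :
    (mono (-9, -4) * numerator * stepPoly steps ^ n).coeff (i, j) = 0 := by
  have hz : ∀ a b : ℤ, (3 : ℤ) ∣ a → (stepPoly steps ^ n).coeff (i - a, j - b) = 0 := by
    rintro _ b ⟨a, rfl⟩
    exact coeff_stepPoly_pow_eq_zero n _ _ fun k hk => h (n - k - j - a) (by omega)
  rw [coeff_numerator_mul]
  beta_reduce
  rw [hz (3) (-2) (by norm_num),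
    hz (3) (-3) (by norm_num),
    hz (0) (0) (by norm_num),
    hz (0) (-2) (by norm_num),
    hz (0) (-3) (by norm_num),
    hz (0) (-4) (by norm_num),
    hz (-3) (1) (by norm_num),
    hz (-3) (0) (by norm_num),
    hz (-3) (-2) (by norm_num),
    hz (-3) (-3) (by norm_num),
    hz (-6) (1) (by norm_num),
    hz (-6) (0) (by norm_num),
    hz (-9) (2) (by norm_num),
    hz (-9) (1) (by norm_num)]
  norm_num

theorem coeff_Q_eq_walkCount (S : Finset (ℤ × ℤ)) (n : ℕ) (p : ℤ × ℤ) :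
    (PowerSeries.coeff n (Q S)).coeff p = walkCount S p n := by
  classical
  simp [Q, walkCount, mono, Finsupp.single_apply]

theorem coeff_numerator_mul_eq_walkCount {i j : ℤ} (n : ℕ) (hi : 0 ≤ i) (hj : 0 ≤ j) :
    (mono (-9, -4) * numerator * stepPoly steps ^ n).coeff (i, j) = walkCount steps (i, j) n := by
  obtain ⟨h1, h2⟩ := walkCount_steps n i j (by omega) (by omega)
  by_cases hex : ∃ m : ℤ, (n : ℤ) = i + 3 * j + 3 * m
  · obtain ⟨m, hm⟩ := hex
    rw [h1 m hm, coeff_numerator_mul_eq_closedForm hm]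
  · push Not at hex
    rw [h2 hex, coeff_numerator_mul_eq_zero hex, Nat.cast_zero]

theorem one_sub_X_mul_C_mul_mk_pow {R : Type*} [CommRing R] (a : R) :
    (1 - PowerSeries.X * PowerSeries.C a) * PowerSeries.mk (fun n => a ^ n) = 1 := by
  ext n
  rw [sub_mul, one_mul, mul_assoc, map_sub, PowerSeries.coeff_mk]
  cases n with
  | zero => simp
  | succ n =>
    rw [PowerSeries.coeff_succ_X_mul, PowerSeries.coeff_C_mul, PowerSeries.coeff_mk, pow_succ',
      sub_self, PowerSeries.coeff_one, if_neg n.succ_ne_zero]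

theorem isUnit_denominator_and_Q_steps_eq :
    let N : PowerSeries Laurent := PowerSeries.C
        ((2 - y) * (x ^ 3 - y ^ 2) * (x ^ 6 * y - 3 * x ^ 3 * y - x ^ 3 - y ^ 2) * (x ^ 3 - 2 * y))
    let D : PowerSeries Laurent :=
        PowerSeries.C (x ^ 9 * y ^ 4) * (1 - PowerSeries.X * PowerSeries.C (stepPoly steps))
    IsUnit D ∧ Q steps = nonnegPart (N * Ring.inverse D) := by
  intro N D
  -- The monomial `x⁹y⁴` is a unit among Laurent polynomials, and `1 - tS` is inverted by the
  -- geometric series.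
  have hinv : (PowerSeries.C (mono (-9, -4)) * PowerSeries.mk fun n => stepPoly steps ^ n) * D
      = 1 := by
    have h1 : mono (-9, -4) * (x ^ 9 * y ^ 4) = 1 := by
      rw [x_pow_mul_y_pow, mono_mul_mono]
      exact mono_zero
    calc _ = PowerSeries.C (mono (-9, -4) * (x ^ 9 * y ^ 4)) *
          ((1 - PowerSeries.X * PowerSeries.C (stepPoly steps)) *
            PowerSeries.mk fun n => stepPoly steps ^ n) := by
          simp only [D, map_mul]; ring
      _ = 1 := by rw [one_sub_X_mul_C_mul_mk_pow, h1, map_one, one_mul]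
  have hD : IsUnit D := IsUnit.of_mul_eq_one_right _ hinv
  refine ⟨hD, ?_⟩
  have hinverse : Ring.inverse D =
      PowerSeries.C (mono (-9, -4)) * PowerSeries.mk fun n => stepPoly steps ^ n :=
    (left_inv_eq_right_inv hinv (Ring.mul_inverse_cancel D hD)).symm
  rw [hinverse]
  ext n ⟨i, j⟩
  rw [coeff_Q_eq_walkCount, nonnegPart, PowerSeries.coeff_mk, Laurent.nonneg,
    AddMonoidAlgebra.coeff_ofCoeff]
  by_cases hp : 0 ≤ i ∧ 0 ≤ j
  · rw [Finsupp.filter_apply, if_pos (by exact hp), ← coeff_numerator_mul_eq_walkCount n hp.1 hp.2,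
      ← mul_assoc, ← map_mul, PowerSeries.coeff_C_mul, PowerSeries.coeff_mk,
      mul_comm (mono (-9, -4))]
    rfl
  · rw [Finsupp.filter_apply, if_neg (by exact hp), walkCount_eq_zero _ hp, Nat.cast_zero]

/-! ### Binomial probabilities -/

/-- The probability that a binomial variable of parameters `N` and `1 / 3` takes the value `k`. -/
def binomWeight (N k : ℕ) : ℝ := N.choose k * 2 ^ N / (2 ^ k * 3 ^ N)

theorem binomWeight_nonneg (N k : ℕ) : 0 ≤ binomWeight N k := by
  unfold binomWeight; positivity

theorem binomWeight_succ_zero (N : ℕ) : binomWeight (N + 1) 0 = 2 / 3 * binomWeight N 0 := by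
  simp only [binomWeight, Nat.choose_zero_right, pow_succ]
  field_simp

theorem binomWeight_succ_succ (N k : ℕ) :
    binomWeight (N + 1) (k + 1) = 1 / 3 * binomWeight N k + 2 / 3 * binomWeight N (k + 1) := by
  simp only [binomWeight, Nat.choose_succ_succ, pow_succ]
  push_cast
  field_simp

/-- Each entry of row `N + 1` is an average of entries of row `N`, with total weight at most one, so
upper bounds pass to later rows. -/
theorem binomWeight_le_of_le {N M : ℕ} (h : N ≤ M) {B : ℝ} (hB : ∀ k, binomWeight N k ≤ B) (k : ℕ) :
    binomWeight M k ≤ B := by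
  induction M, h using Nat.le_induction generalizing k with
  | base => exact hB k
  | succ M _ ih =>
    cases k with
    | zero =>
      rw [binomWeight_succ_zero]
      linarith [ih 0, binomWeight_nonneg M 0]
    | succ k =>
      rw [binomWeight_succ_succ]
      linarith [ih k, ih (k + 1)]

theorem binomWeight_succ_right {N k : ℕ} (h : k ≤ N) :
    2 * (k + 1) * binomWeight N (k + 1) = (N - k) * binomWeight N k := by
  have := Nat.choose_succ_right_eq N k
  have h' : (N.choose (k + 1) : ℝ) * (k + 1) = N.choose k * (N - k) := by
    rw [← Nat.cast_sub h]; exact_mod_cast this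
  simp only [binomWeight, pow_succ]
  field_simp
  linear_combination h'

/-- The ratio of consecutive weights is `(3M - k)/(2(k + 1))`, at least one for `k < M` and at most
one for `k ≥ M`. -/
theorem binomWeight_three_mul_le (M k : ℕ) : binomWeight (3 * M) k ≤ binomWeight (3 * M) M := by
  rcases le_total k M with h | h
  · induction h using Nat.decreasingInduction with
    | self => exact le_rfl
    | of_succ k hk ih =>
      refine le_trans ?_ ih
      have h1 := binomWeight_succ_right (N := 3 * M) (k := k) (by omega)
      have h2 : (k : ℝ) + 1 ≤ M := by exact_mod_cast hk
      push_cast at h1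
      have h3 : 0 < 2 * ((k : ℝ) + 1) := by positivity
      rw [← mul_le_mul_iff_right₀ h3, h1]
      exact mul_le_mul_of_nonneg_right (by linarith) (binomWeight_nonneg _ _)
  · induction k, h using Nat.le_induction with
    | base => exact le_rfl
    | succ k hk ih =>
      refine le_trans ?_ ih
      rcases lt_or_ge (3 * M) (k + 1) with hlt | hle
      · simp [binomWeight, Nat.choose_eq_zero_of_lt hlt]
        positivity
      have h1 := binomWeight_succ_right (N := 3 * M) (k := k) (by omega)
      have h2 : (M : ℝ) ≤ k := by exact_mod_cast hk
      push_cast at h1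
      have h3 : 0 < 2 * ((k : ℝ) + 1) := by positivity
      rw [← mul_le_mul_iff_right₀ h3, h1]
      exact mul_le_mul_of_nonneg_right (by linarith) (binomWeight_nonneg _ _)

theorem choose_add_cast (a b : ℕ) : ((a + b).choose a : ℝ) = (a + b)! / (a ! * b !) := by
  rw [eq_div_iff (by positivity), ← mul_assoc]
  have := Nat.add_choose_mul_factorial_mul_factorial a b
  rw [Nat.choose_symm_add] at *
  exact_mod_cast this

theorem factorial_eq_stirlingSeq {n : ℕ} (hn : n ≠ 0) :
    (n ! : ℝ) = Stirling.stirlingSeq n * (√(2 * n) * (n / Real.exp 1) ^ n) := by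
  have : (0 : ℝ) < n := by positivity
  rw [Stirling.stirlingSeq, div_mul_cancel₀]
  positivity

theorem tendsto_binomWeight_three_mul :
    ∃ L : ℝ, 0 < L ∧ Tendsto (fun m : ℕ => binomWeight (3 * m) m * √m) atTop (nhds L) := by
  have hπ : (0 : ℝ) < √Real.pi := Real.sqrt_pos.2 Real.pi_pos
  -- The factors `√π` are limits of `Stirling.stirlingSeq`; the rest comes from the square roots
  -- `√(2k)` at `k = 3m, m, 2m`. The value is `√(3/(4π))`.
  refine ⟨√Real.pi / (√Real.pi * √Real.pi) * (√6 / (√2 * 2)), by positivity, ?_⟩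
  have h1 := Stirling.tendsto_stirlingSeq_sqrt_pi
  have h2 : Tendsto (fun m : ℕ => Stirling.stirlingSeq (2 * m)) atTop (nhds √Real.pi) :=
    h1.comp (tendsto_id.const_mul_atTop' (by norm_num))
  have h3 : Tendsto (fun m : ℕ => Stirling.stirlingSeq (3 * m)) atTop (nhds √Real.pi) :=
    h1.comp (tendsto_id.const_mul_atTop' (by norm_num))
  refine ((h3.div (h1.mul h2) (by positivity)).mul_const (√6 / (√2 * 2))).congr' ?_
  filter_upwards [eventually_ne_atTop 0] with m hm
  have hm0 : (0 : ℝ) < m := by positivity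
  have hs1 : 0 < Stirling.stirlingSeq m := by
    rw [Stirling.stirlingSeq]; positivity
  have hs2 : 0 < Stirling.stirlingSeq (2 * m) := by
    rw [Stirling.stirlingSeq]; positivity
  have hc : ((3 * m).choose m : ℝ) = (3 * m)! / (m ! * (2 * m)!) := by
    rw [show 3 * m = m + 2 * m by ring, choose_add_cast]
  have e1 : √(2 * (m : ℝ)) = √2 * √m := Real.sqrt_mul (by norm_num) _
  have e2 : √(2 * ((2 * m : ℕ) : ℝ)) = 2 * √m := by
    rw [Nat.cast_mul, ← mul_assoc, Real.sqrt_mul (by norm_num), Nat.cast_ofNat,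
      Real.sqrt_mul_self (by norm_num)]
  have e3 : √(2 * ((3 * m : ℕ) : ℝ)) = √6 * √m := by
    rw [Nat.cast_mul, ← mul_assoc, Real.sqrt_mul (by norm_num)]; norm_num
  have p2 : (((2 * m : ℕ) : ℝ) / Real.exp 1) ^ (2 * m) = 4 ^ m * ((m / Real.exp 1) ^ m) ^ 2 := by
    rw [Nat.cast_mul, mul_div_assoc, mul_pow, pow_mul, ← pow_mul' _ 2 m]; norm_num
  have p3 : (((3 * m : ℕ) : ℝ) / Real.exp 1) ^ (3 * m) = 27 ^ m * ((m / Real.exp 1) ^ m) ^ 3 := by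
    rw [Nat.cast_mul, mul_div_assoc, mul_pow, pow_mul, ← pow_mul' _ 3 m]; norm_num
  have hp : 0 < ((m : ℝ) / Real.exp 1) ^ m := by positivity
  have hw : binomWeight (3 * m) m = (3 * m).choose m * (4 ^ m / 27 ^ m) := by
    rw [binomWeight, pow_mul, pow_mul]
    norm_num
    rw [show (8 : ℝ) = 2 * 4 by norm_num, mul_pow]
    field_simp
  have ht : 0 < √(m : ℝ) := Real.sqrt_pos.2 hm0
  simp only [Pi.div_apply]
  rw [hw, hc, factorial_eq_stirlingSeq hm, factorial_eq_stirlingSeq (n := 2 * m) (by omega),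
    factorial_eq_stirlingSeq (n := 3 * m) (by omega), e1, e2, e3, p2, p3]
  field_simp

theorem tendsto_affine_div (a b c d : ℝ) (hc : c ≠ 0) :
    Tendsto (fun m : ℕ => (a * m + b) / (c * m + d)) atTop (nhds (a / c)) := by
  have h0 : Tendsto (fun m : ℕ => 1 / (m : ℝ)) atTop (nhds 0) := tendsto_one_div_atTop_nhds_zero_nat
  have h := ((h0.const_mul b).const_add a).div ((h0.const_mul d).const_add c) (by simpa using hc)
  simp only [mul_zero, add_zero] at h
  refine h.congr' ?_
  filter_upwards [eventually_ne_atTop 0] with m hm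
  have hm0 : (m : ℝ) ≠ 0 := by exact_mod_cast hm
  simp only [Pi.div_apply]
  rw [← mul_div_mul_right _ _ hm0]
  congr 1 <;> field_simp

/-- Raising `d` or `e` by one multiplies the weight by a ratio of affine functions of `m`, with
limit `3 · 1/3` or `3/2 · 2/3`, so bounded shifts do not change the limit. -/
theorem tendsto_binomWeight {L : ℝ}
    (hL : Tendsto (fun m : ℕ => binomWeight (3 * m) m * √m) atTop (nhds L)) (d e : ℕ) :
    Tendsto (fun m : ℕ => binomWeight (3 * m + d + e) (m + d) * √m) atTop (nhds L) := by
  have hw : ∀ d e m : ℕ, binomWeight (3 * m + d + e) (m + d) =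
      (3 * m + d + e)! / ((m + d)! * (2 * m + e)!) * 2 ^ (3 * m + d + e) /
        (2 ^ (m + d) * 3 ^ (3 * m + d + e)) := by
    intro d e m
    rw [binomWeight, show 3 * m + d + e = (m + d) + (2 * m + e) by ring, choose_add_cast]
  induction d with
  | zero =>
    induction e with
    | zero => simpa using hL
    | succ e ih =>
      have h := ih.mul ((tendsto_affine_div 3 (0 + e + 1) 2 (e + 1) (by norm_num)).mul_const (2 / 3))
      norm_num at h
      refine h.congr fun m => ?_
      rw [show 3 * m + e = 3 * m + 0 + e by ring,
        show binomWeight (3 * m + 0 + e) m = binomWeight (3 * m + 0 + e) (m + 0) from rfl, hw, hw]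
      rw [show 3 * m + 0 + (e + 1) = (3 * m + 0 + e) + 1 by ring,
        show 2 * m + (e + 1) = 2 * m + e + 1 by ring, Nat.factorial_succ (3 * m + 0 + e),
        Nat.factorial_succ (2 * m + e), pow_succ, pow_succ]
      push_cast
      field_simp
      ring
  | succ d ih =>
    have h := ih.mul ((tendsto_affine_div 3 (d + e + 1) 1 (d + 1) (by norm_num)).mul_const (1 / 3))
    norm_num at h
    refine h.congr fun m => ?_
    rw [hw, hw, show 3 * m + (d + 1) + e = (3 * m + d + e) + 1 by ring,
      show m + (d + 1) = m + d + 1 by ring, Nat.factorial_succ (3 * m + d + e),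
      Nat.factorial_succ (m + d), pow_succ, pow_succ, pow_succ]
    push_cast
    field_simp
    ring

theorem exists_binomWeight_le :
    ∃ K : ℝ, 0 < K ∧ ∀ N k : ℕ, 3 ≤ N → binomWeight N k * √N ≤ K := by
  obtain ⟨L, -, hL⟩ := tendsto_binomWeight_three_mul
  obtain ⟨B, hB⟩ := hL.bddAbove_range
  have hB' : ∀ m : ℕ, binomWeight (3 * m) m * √m ≤ B := fun m => hB ⟨m, rfl⟩
  have hB0 : 0 ≤ B := by simpa using hB' 0
  refine ⟨(B + 1) * √5, by positivity, fun N k hN => ?_⟩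
  set M := N / 3 with hM
  have hM1 : 1 ≤ M := by omega
  have hMpos : 0 < √(M : ℝ) := Real.sqrt_pos.2 (by exact_mod_cast hM1)
  have h1 : binomWeight N k ≤ B / √M :=
    binomWeight_le_of_le (N := 3 * M) (by omega) (fun k => (binomWeight_three_mul_le M k).trans
      ((le_div_iff₀ hMpos).2 (hB' M))) k
  have h2 : √(N : ℝ) ≤ √5 * √M := by
    rw [← Real.sqrt_mul (by norm_num)]
    apply Real.sqrt_le_sqrt
    -- `N ≤ 3M + 2` and `M ≥ 1`.
    exact_mod_cast (by omega : N ≤ 5 * M)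
  calc binomWeight N k * √N ≤ B / √M * (√5 * √M) := by gcongr
    _ = B * √5 := by field_simp
    _ ≤ (B + 1) * √5 := by gcongr; linarith

/-! ### Asymptotics -/

theorem growth_pow_identity {μ : ℝ} (hμ : 0 < μ) (h3 : μ ^ 3 = 729 / 16) (i j m : ℕ) :
    6561 / 128 * (9 / (4 * μ)) ^ i * (1 / 2) ^ j *
      (2 ^ (i + 3 * j + 3 * m + 4) / (2 ^ m * 3 ^ (i + 3 * j + 3 * m + 4)) *
        (2 ^ (i + 3 * j + 3 * m + 4) / (2 ^ (m + j + 1) * 3 ^ (i + 3 * j + 3 * m + 4)))) =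
      1 / μ ^ (i + 3 * j + 3 * m) := by
  have e : ∀ a : ℝ, a ^ (i + 3 * j + 3 * m) = a ^ i * (a ^ 3) ^ j * (a ^ 3) ^ m := by
    intro a; rw [pow_add, pow_add, pow_mul, pow_mul]
  rw [pow_add (2 : ℝ) (i + 3 * j + 3 * m) 4, pow_add (3 : ℝ) (i + 3 * j + 3 * m) 4, e μ, e 2, e 3, h3, div_pow, mul_pow, pow_add _ (m + j),
    pow_add _ m, div_pow, div_pow, div_pow, show (9 : ℝ) = 3 * 3 by norm_num,
    show (729 : ℝ) = 3 ^ 3 * 3 ^ 3 by norm_num, show (16 : ℝ) = 2 * 2 * 2 * 2 by norm_num,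
    show (4 : ℝ) = 2 * 2 by norm_num]
  simp only [mul_pow]
  field_simp
  norm_num
  have e8 : ∀ k : ℕ, (8 : ℝ) ^ k = 2 ^ (3 * k) := fun k => by rw [pow_mul]; norm_num
  simp only [e8]
  ring

/-- The four factorials pair up, as `m + (2m + i + 3j + 4)` and `(m + j + 1) + (2m + i + 2j + 3)`
both equal `n + 4`. The rational factor is `n! (n + 3)!/(n + 4)!²`, times `n⁵`. -/
theorem q_steps_mul_eq {μ : ℝ} (hμ : 0 < μ) (h3 : μ ^ 3 = 729 / 16) {i j m n : ℕ}
    (h : n = i + 3 * j + 3 * m) :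
    (q steps i j n : ℝ) * (n : ℝ) ^ 5 / μ ^ n =
      6561 / 128 * (9 / (4 * μ)) ^ i * (1 / 2) ^ j *
        ((i + 1) * (j + 1) * (i + 3 * j + 4) *
          ((i + 2 * j + 2) * (i + 2 * j + 3) + m * (2 * i + 3 * j + 4))) *
        ((n : ℝ) ^ 5 / ((n + 1) * (n + 2) * (n + 3) * (n + 4) ^ 2)) *
        (binomWeight (n + 4) m * binomWeight (n + 4) (m + j + 1)) := by
  have hq : (q steps i j n : ℝ) =
      ((i + 1) * (j + 1) * (i + 3 * j + 4) *
          ((i + 2 * j + 2) * (i + 2 * j + 3) + m * (2 * i + 3 * j + 4)) * n ! * (n + 3)!) /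
        (m ! * (m + j + 1)! * (2 * m + i + 2 * j + 3)! * (2 * m + i + 3 * j + 4)!) := by
    have := congrArg (Rat.cast : ℚ → ℝ) (q_steps_eq h)
    push_cast at this
    exact this
  have c1 : ((n + 4).choose m : ℝ) = (n + 4)! / (m ! * (2 * m + i + 3 * j + 4)!) := by
    rw [show n + 4 = m + (2 * m + i + 3 * j + 4) by omega, choose_add_cast]
  have c2 : ((n + 4).choose (m + j + 1) : ℝ) =
      (n + 4)! / ((m + j + 1)! * (2 * m + i + 2 * j + 3)!) := by
    rw [show n + 4 = (m + j + 1) + (2 * m + i + 2 * j + 3) by omega, choose_add_cast]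
  have hpow := growth_pow_identity hμ h3 i j m
  rw [← h] at hpow
  have f3 : ((n + 3)! : ℝ) = (n + 3) * ((n + 2) * ((n + 1) * n !)) := by
    rw [Nat.factorial_succ, Nat.factorial_succ, Nat.factorial_succ]; push_cast; ring
  have f4 : ((n + 4)! : ℝ) = (n + 4) * ((n + 3) * ((n + 2) * ((n + 1) * n !))) := by
    rw [Nat.factorial_succ, Nat.cast_mul, f3]; push_cast; ring
  rw [hq, div_eq_mul_one_div _ (μ ^ n), ← hpow, binomWeight, binomWeight, c1, c2, f3, f4]
  field_simp

/-- Beyond `c`, the residue class consists exactly of the numbers `c + p m`. -/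
theorem tendsto_inf_principal_modEq {β : Type*} {f : ℕ → β} {l : Filter β} (c p r : ℕ)
    (hp : 0 < p) (hc : c ≡ r [MOD p]) (h : Tendsto (fun m => f (c + p * m)) atTop l) :
    Tendsto f (atTop ⊓ 𝓟 {n | n ≡ r [MOD p]}) l := by
  have ht : Tendsto (fun n : ℕ => (n - c) / p) (atTop ⊓ 𝓟 {n | n ≡ r [MOD p]}) atTop :=
    ((Nat.tendsto_div_const_atTop hp.ne').comp (tendsto_sub_atTop_nat c)).mono_left inf_le_left
  refine (h.comp ht).congr' ?_
  have h1 : ∀ᶠ n in atTop ⊓ 𝓟 {n | n ≡ r [MOD p]}, c ≤ n :=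
    (eventually_ge_atTop c).filter_mono inf_le_left
  have h2 : ∀ᶠ n in atTop ⊓ 𝓟 {n | n ≡ r [MOD p]}, n ≡ r [MOD p] :=
    mem_inf_of_right (mem_principal_self _)
  filter_upwards [h1, h2] with n hn hn'
  have hd : p ∣ n - c := (Nat.modEq_iff_dvd' hn).1 (hc.trans hn'.symm)
  simp only [Function.comp]
  rw [Nat.mul_div_cancel' hd, Nat.add_sub_cancel' hn]

theorem hasExponent_of_tendsto {a : ℕ → ℕ} {p r : ℕ} {μ κ : ℝ} (hκ : 0 < κ)
    (h : Tendsto (fun n => (a n : ℝ) * (n : ℝ) ^ 5 / μ ^ n) (atTop ⊓ 𝓟 {n | n ≡ r [MOD p]})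
      (nhds κ)) : HasExponent a p r μ (-5) := by
  refine ⟨κ, hκ, isEquivalent_of_tendsto_one ?_⟩
  have h' := h.div_const κ
  rw [div_self hκ.ne'] at h'
  refine h'.congr fun n => ?_
  rw [Pi.div_apply, Real.rpow_neg (Nat.cast_nonneg n), show (5 : ℝ) = ((5 : ℕ) : ℝ) by norm_num,
    Real.rpow_natCast, div_div, ← div_eq_mul_inv, div_div_eq_mul_div, mul_comm (μ ^ n)]

/-- The constant in the asymptotics of `q(i, j; n)`, where `L` is the limit of the rescaled
central binomial probabilities. -/
def excursionConst (μ L : ℝ) (i j : ℕ) : ℝ :=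
  6561 / 128 * (9 / (4 * μ)) ^ i * (1 / 2) ^ j *
    ((i + 1) * (j + 1) * (i + 3 * j + 4) * (2 * i + 3 * j + 4)) * (L * L)

theorem excursionConst_pos {μ L : ℝ} (hμ : 0 < μ) (hL : 0 < L) (i j : ℕ) :
    0 < excursionConst μ L i j := by
  unfold excursionConst; positivity

theorem tendsto_q_steps {μ L : ℝ} (hμ : 0 < μ) (h3 : μ ^ 3 = 729 / 16)
    (hL : Tendsto (fun m : ℕ => binomWeight (3 * m) m * √m) atTop (nhds L)) {i j r : ℕ}
    (hr : i ≡ r [MOD 3]) :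
    Tendsto (fun n => (q steps i j n : ℝ) * (n : ℝ) ^ 5 / μ ^ n)
      (atTop ⊓ 𝓟 {n | n ≡ r [MOD 3]}) (nhds (excursionConst μ L i j)) := by
  refine tendsto_inf_principal_modEq (i + 3 * j) 3 r (by norm_num)
    (by rw [Nat.ModEq, Nat.add_mul_mod_self_left]; exact hr) ?_
  have hb1 := tendsto_binomWeight hL 0 (i + 3 * j + 4)
  have hb2 := tendsto_binomWeight hL (j + 1) (i + 2 * j + 3)
  have hr : ∀ b : ℝ, Tendsto (fun m : ℕ => (3 * (m : ℝ) + (i + 3 * j)) / (3 * m + (i + 3 * j + b)))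
      atTop (nhds (3 / 3)) := fun b => tendsto_affine_div _ _ _ _ (by norm_num)
  have hrat := (((hr 1).mul (hr 2)).mul (hr 3)).mul ((hr 4).mul (hr 4))
  -- This factor is divided by `m`, which the two `√m` of the weights compensate.
  have hpoly := tendsto_affine_div (2 * i + 3 * j + 4) ((i + 2 * j + 2) * (i + 2 * j + 3)) 1 0
    one_ne_zero
  have key := ((hpoly.const_mul (6561 / 128 * (9 / (4 * μ)) ^ i * (1 / 2) ^ j *
    ((i + 1) * (j + 1) * (i + 3 * j + 4)))).mul hrat).mul (hb1.mul hb2)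
  have hlim : 6561 / 128 * (9 / (4 * μ)) ^ i * (1 / 2) ^ j *
      (((i : ℝ) + 1) * (j + 1) * (i + 3 * j + 4)) * ((2 * i + 3 * j + 4) / 1) *
      (3 / 3 * (3 / 3) * (3 / 3) * (3 / 3 * (3 / 3))) * (L * L) = excursionConst μ L i j := by
    unfold excursionConst; ring
  rw [hlim] at key
  refine key.congr' ?_
  filter_upwards [eventually_ne_atTop 0] with m hm
  have hm0 : (0 : ℝ) < m := by positivity
  rw [q_steps_mul_eq hμ h3 rfl, show i + 3 * j + 3 * m + 4 = 3 * m + 0 + (i + 3 * j + 4) by ring,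
    show binomWeight (3 * m + 0 + (i + 3 * j + 4)) (m + j + 1) =
      binomWeight (3 * m + (j + 1) + (i + 2 * j + 3)) (m + (j + 1)) by congr 1; ring, add_zero m]
  have hs : √(m : ℝ) * √(m : ℝ) = m := Real.mul_self_sqrt hm0.le
  generalize binomWeight (3 * m + 0 + (i + 3 * j + 4)) m = b₁
  generalize binomWeight (3 * m + (j + 1) + (i + 2 * j + 3)) (m + (j + 1)) = b₂
  rw [show b₁ * √(m : ℝ) * (b₂ * √(m : ℝ)) = b₁ * b₂ * m by
    linear_combination b₁ * b₂ * hs]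
  push_cast
  field_simp
  ring

/-- A bound of the rescaled numbers `q(i, j; n)` that is uniform in `n`. -/
def excursionBound (μ K : ℝ) (p : ℕ × ℕ) : ℝ :=
  6561 / 128 * 24 * K ^ 2 * ((((p.1 : ℝ) + 1) ^ 4 * (9 / (4 * μ)) ^ p.1) *
    (((p.2 : ℝ) + 1) ^ 4 * (1 / 2) ^ p.2))

theorem excursionBound_nonneg {μ K : ℝ} (hμ : 0 < μ) (p : ℕ × ℕ) : 0 ≤ excursionBound μ K p := by
  unfold excursionBound; positivity

theorem summable_succ_pow_mul_geometric {θ : ℝ} (h0 : 0 < θ) (h1 : θ < 1) (k : ℕ) :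
    Summable fun i : ℕ => ((i : ℝ) + 1) ^ k * θ ^ i := by
  have h := (summable_nat_add_iff 1).2
    (summable_pow_mul_geometric_of_norm_lt_one k (r := θ) (by rwa [Real.norm_of_nonneg h0.le]))
  refine (h.mul_right θ⁻¹).congr fun i => ?_
  rw [pow_succ]
  push_cast
  field_simp

theorem summable_excursionBound {μ : ℝ} (hμ : 9 / 4 < μ) (K : ℝ) :
    Summable (excursionBound μ K) := by
  have hθ0 : 0 < 9 / (4 * μ) := by positivity
  have hθ1 : 9 / (4 * μ) < 1 := by rw [div_lt_one (by positivity)]; linarith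
  exact ((summable_succ_pow_mul_geometric hθ0 hθ1 4).mul_of_nonneg
    (summable_succ_pow_mul_geometric (θ := 1 / 2) (by norm_num) (by norm_num) 4)
    (fun _ => by positivity) (fun _ => by positivity)).mul_left _

/-- Both weights are `O((n + 4)^(-1/2))` uniformly in `k`, which absorbs the one factor `n + 4` from
the polynomial. What remains is polynomial in `i`, `j` times a geometric factor in each. -/
theorem q_steps_mul_le {μ K : ℝ} (hμ : 0 < μ) (h3 : μ ^ 3 = 729 / 16) (hK : 0 < K)
    (hb : ∀ N k : ℕ, 3 ≤ N → binomWeight N k * √N ≤ K) (i j n : ℕ) :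
    (q steps i j n : ℝ) * (n : ℝ) ^ 5 / μ ^ n ≤ excursionBound μ K (i, j) := by
  by_cases hex : ∃ m : ℕ, n = i + 3 * j + 3 * m
  swap
  · rw [q_steps_eq_zero fun m hm => hex ⟨m, hm⟩]
    simpa using excursionBound_nonneg hμ (i, j)
  obtain ⟨m, hm⟩ := hex
  rw [q_steps_mul_eq hμ h3 hm]
  have hw : binomWeight (n + 4) m * binomWeight (n + 4) (m + j + 1) * (n + 4) ≤ K ^ 2 := by
    have h1 := hb (n + 4) m (by omega)
    have h2 := hb (n + 4) (m + j + 1) (by omega)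
    have hs : √((n + 4 : ℕ) : ℝ) * √((n + 4 : ℕ) : ℝ) = n + 4 := by
      rw [Real.mul_self_sqrt (by positivity)]; push_cast; rfl
    have := mul_le_mul h1 h2 (mul_nonneg (binomWeight_nonneg _ _) (Real.sqrt_nonneg _)) hK.le
    calc _ = binomWeight (n + 4) m * √((n + 4 : ℕ) : ℝ) *
          (binomWeight (n + 4) (m + j + 1) * √((n + 4 : ℕ) : ℝ)) := by rw [← hs]; ring
      _ ≤ _ := by rw [sq]; exact this
  have hw0 : 0 ≤ binomWeight (n + 4) m * binomWeight (n + 4) (m + j + 1) :=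
    mul_nonneg (binomWeight_nonneg _ _) (binomWeight_nonneg _ _)
  have hi : (0 : ℝ) ≤ i := Nat.cast_nonneg i
  have hj : (0 : ℝ) ≤ j := Nat.cast_nonneg j
  have hij : (0 : ℝ) ≤ i * j := mul_nonneg hi hj
  have hm0 : (0 : ℝ) ≤ m := Nat.cast_nonneg m
  have hn0 : (0 : ℝ) ≤ n := Nat.cast_nonneg n
  have hmn : (m : ℝ) + 1 ≤ n + 4 := by exact_mod_cast (by omega : m + 1 ≤ n + 4)
  set X : ℝ := (i + 1) * (j + 1) with hX
  have hX1 : 1 ≤ X := by rw [hX]; nlinarith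
  have p1 : (i : ℝ) + 3 * j + 4 ≤ 4 * X := by rw [hX]; nlinarith
  have p2 : ((i : ℝ) + 2 * j + 2) * (i + 2 * j + 3) ≤ 6 * X ^ 2 := by
    have a1 : (i : ℝ) + 2 * j + 2 ≤ 2 * X := by rw [hX]; nlinarith
    have a2 : (i : ℝ) + 2 * j + 3 ≤ 3 * X := by rw [hX]; nlinarith
    calc _ ≤ 2 * X * (3 * X) := by gcongr
      _ = _ := by ring
  have p3 : (2 * i + 3 * j + 4 : ℝ) ≤ 6 * X ^ 2 := by
    have a1 : (2 * i + 3 * j + 4 : ℝ) ≤ 4 * X := by rw [hX]; nlinarith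
    nlinarith
  have hpoly : ((i : ℝ) + 1) * (j + 1) * (i + 3 * j + 4) *
      ((i + 2 * j + 2) * (i + 2 * j + 3) + m * (2 * i + 3 * j + 4)) ≤ 24 * X ^ 4 * (n + 4) :=
    calc _ ≤ X * (4 * X) * (6 * X ^ 2 + m * (6 * X ^ 2)) := by gcongr
      _ = 24 * X ^ 4 * (m + 1) := by ring
      _ ≤ _ := by gcongr
  have hrat : (n : ℝ) ^ 5 / ((n + 1) * (n + 2) * (n + 3) * (n + 4) ^ 2) ≤ 1 := by
    rw [div_le_one (by positivity)]
    calc (n : ℝ) ^ 5 = n * n * n * n ^ 2 := by ring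
      _ ≤ _ := by gcongr <;> linarith
  calc _ ≤ 6561 / 128 * (9 / (4 * μ)) ^ i * (1 / 2) ^ j * (24 * X ^ 4 * (n + 4)) * 1 *
        (binomWeight (n + 4) m * binomWeight (n + 4) (m + j + 1)) := by gcongr
    _ = 6561 / 128 * 24 * ((9 / (4 * μ)) ^ i * (1 / 2) ^ j * X ^ 4) *
        (binomWeight (n + 4) m * binomWeight (n + 4) (m + j + 1) * (n + 4)) := by ring
    _ ≤ 6561 / 128 * 24 * ((9 / (4 * μ)) ^ i * (1 / 2) ^ j * X ^ 4) * K ^ 2 := by gcongr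
    _ = _ := by rw [excursionBound, hX]; ring

theorem qTotal_steps_eq_tsum (n : ℕ) :
    (qTotal steps n : ℝ) = ∑' p : ℕ × ℕ, (q steps p.1 p.2 n : ℝ) := by
  have hsupp : ∀ p : ℕ × ℕ, p ∉ Finset.range (n + 1) ×ˢ Finset.range (n + 1) →
      q steps p.1 p.2 n = 0 := by
    intro p hp
    refine q_steps_eq_zero fun m hm => hp ?_
    rw [Finset.mem_product, Finset.mem_range, Finset.mem_range]
    omega
  have hq : ∀ p : ℕ × ℕ, q steps p.1 p.2 n = ((walks steps n).filter fun w =>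
      ((endpoint w).1.toNat, (endpoint w).2.toNat) = p).card := by
    rintro ⟨i, j⟩
    rw [q]
    congr 1
    refine Finset.filter_congr fun w hw => ?_
    have := endpoint_nonneg hw
    rw [Prod.ext_iff, Prod.ext_iff]
    simp only
    omega
  rw [tsum_eq_sum fun p hp => by rw [hsupp p hp, Nat.cast_zero], ← Nat.cast_sum, qTotal,
    Finset.card_eq_sum_card_fiberwise
      (f := fun w : Fin n → ℤ × ℤ => ((endpoint w).1.toNat, (endpoint w).2.toNat))
      (t := Finset.range (n + 1) ×ˢ Finset.range (n + 1))]
  · simp only [hq]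
  · intro w hw
    by_contra hout
    have h0 := hsupp _ hout
    rw [hq, Finset.card_eq_zero, Finset.filter_eq_empty_iff] at h0
    exact h0 hw rfl

theorem hasExponent_q_steps {μ : ℝ} (hμ : 0 < μ) (h3 : μ ^ 3 = 729 / 16) (i j : ℕ) :
    HasExponent (q steps i j) 3 i μ (-5) := by
  obtain ⟨L, hL0, hL⟩ := tendsto_binomWeight_three_mul
  exact hasExponent_of_tendsto (excursionConst_pos hμ hL0 i j)
    (tendsto_q_steps hμ h3 hL (Nat.ModEq.refl i))

/-- Dominated convergence over the endpoints: `κ_r` is the sum of the excursion constants with `i ≡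
r`. The condition `9/4 < μ` makes the ratio `9/(4μ)` of the bound less than one. -/
theorem hasExponent_qTotal_steps {μ : ℝ} (hμ : 9 / 4 < μ) (h3 : μ ^ 3 = 729 / 16) (r : ℕ) :
    HasExponent (qTotal steps) 3 r μ (-5) := by
  obtain ⟨L, hL0, hL⟩ := tendsto_binomWeight_three_mul
  obtain ⟨K, hK, hb⟩ := exists_binomWeight_le
  have hμ0 : 0 < μ := by linarith
  set F := atTop ⊓ 𝓟 {n : ℕ | n ≡ r [MOD 3]} with hF
  have : F.NeBot := frequently_mem_iff_neBot.1 (Nat.frequently_modEq (by norm_num) r)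
  let g : ℕ × ℕ → ℝ := fun p => if p.1 ≡ r [MOD 3] then excursionConst μ L p.1 p.2 else 0
  have hg : ∀ p : ℕ × ℕ, Tendsto (fun n => (q steps p.1 p.2 n : ℝ) * (n : ℝ) ^ 5 / μ ^ n) F
      (nhds (g p)) := by
    intro p
    by_cases hp : p.1 ≡ r [MOD 3]
    · simp only [g, if_pos hp]
      exact tendsto_q_steps hμ0 h3 hL hp
    · simp only [g, if_neg hp]
      refine tendsto_const_nhds.congr' ?_
      have h2 : ∀ᶠ n in F, n ≡ r [MOD 3] := mem_inf_of_right (mem_principal_self _)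
      filter_upwards [h2] with n hn
      rw [q_steps_eq_zero, Nat.cast_zero, zero_mul, zero_div]
      intro m hm
      refine hp (Nat.ModEq.trans ?_ hn)
      rw [Nat.ModEq]
      omega
  have hnonneg : ∀ (n : ℕ) (p : ℕ × ℕ), 0 ≤ (q steps p.1 p.2 n : ℝ) * (n : ℝ) ^ 5 / μ ^ n :=
    fun n p => by positivity
  have hle : ∀ (n : ℕ) (p : ℕ × ℕ),
      (q steps p.1 p.2 n : ℝ) * (n : ℝ) ^ 5 / μ ^ n ≤ excursionBound μ K p :=
    fun n p => q_steps_mul_le hμ0 h3 hK hb p.1 p.2 n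
  have hsum := summable_excursionBound hμ K
  have hg0 : ∀ p, 0 ≤ g p := fun p => ge_of_tendsto' (hg p) fun n => hnonneg n p
  have hgsum : Summable g :=
    hsum.of_nonneg_of_le hg0 fun p => le_of_tendsto' (hg p) fun n => hle n p
  have hlim := tendsto_tsum_of_dominated_convergence hsum hg
    (Eventually.of_forall fun n p => by rw [Real.norm_of_nonneg (hnonneg n p)]; exact hle n p)
  refine hasExponent_of_tendsto (κ := ∑' p, g p) ?_ (hlim.congr fun n => ?_)
  -- The endpoint `(r, 0)` is in the right residue class, so its term is positive.
  · refine hgsum.tsum_pos hg0 (r, 0) ?_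
    simp only [g, if_pos (Nat.ModEq.refl r)]
    exact excursionConst_pos hμ0 hL0 _ _
  · rw [qTotal_steps_eq_tsum, tsum_div_const, tsum_mul_right]

theorem growthRate_pow_three : (9 * (4 : ℝ) ^ (-(2 / 3) : ℝ)) ^ 3 = 729 / 16 := by
  rw [mul_pow, ← Real.rpow_natCast ((4 : ℝ) ^ (-(2 / 3) : ℝ)), ← Real.rpow_mul (by norm_num),
    show (-(2 / 3) : ℝ) * ((3 : ℕ) : ℝ) = -((2 : ℕ) : ℝ) by norm_num, Real.rpow_neg (by norm_num),
    Real.rpow_natCast]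
  norm_num

theorem lt_growthRate : 9 / 4 < 9 * (4 : ℝ) ^ (-(2 / 3) : ℝ) := by
  refine lt_of_pow_lt_pow_left₀ 3 (by positivity) ?_
  rw [growthRate_pow_three]
  norm_num

end QuadrantWalk

end

open QuadrantWalk in
theorem proposition7p4 :
    -- the orbit
    (orbit steps).ncard = 18 ∧
    -- the generating function as a non-negative part; the denominator is invertible
    (let N : PowerSeries Laurent := PowerSeries.C
        ((2 - y) * (x ^ 3 - y ^ 2) * (x ^ 6 * y - 3 * x ^ 3 * y - x ^ 3 - y ^ 2) * (x ^ 3 - 2 * y))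
     let D : PowerSeries Laurent :=
        PowerSeries.C (x ^ 9 * y ^ 4) * (1 - PowerSeries.X * PowerSeries.C (stepPoly steps))
     IsUnit D ∧ Q steps = nonnegPart (N * Ring.inverse D)) ∧
    -- the coefficients
    (∀ i j n : ℕ, (∀ m : ℕ, n ≠ i + 3 * j + 3 * m) → q steps i j n = 0) ∧
    (∀ i j m n : ℕ, n = i + 3 * j + 3 * m →
      (q steps i j n : ℚ) =
        ((i + 1) * (j + 1) * (i + 3 * j + 4) *
            ((i + 2 * j + 2) * (i + 2 * j + 3) + m * (2 * i + 3 * j + 4)) * n ! * (n + 3)!) /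
          (m ! * (m + j + 1)! * (2 * m + i + 2 * j + 3)! * (2 * m + i + 3 * j + 4)!)) ∧
    -- the excursion exponent, for every endpoint
    (∀ i j : ℕ, HasExponent (q steps i j) 3 i (9 * (4 : ℝ) ^ (-(2 / 3) : ℝ)) (-5)) ∧
    -- the walk exponent
    (∀ r : ℕ, HasExponent (qTotal steps) 3 r (9 * (4 : ℝ) ^ (-(2 / 3) : ℝ)) (-5)) := by
  exact ⟨ncard_orbit_steps, isUnit_denominator_and_Q_steps_eq, fun _ _ _ h => q_steps_eq_zero h,
    fun _ _ _ _ h => q_steps_eq h,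
    fun i j => hasExponent_q_steps (by positivity) growthRate_pow_three i j,
    fun r => hasExponent_qTotal_steps lt_growthRate growthRate_pow_three r⟩
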